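/- Let $\beta=0.0444443$ and let $$\sigma(\tau)=\frac{e^{\pi\tau/(2\beta)}-1}{e^{\pi\tau/(2\beta)}+1}.$$ This map is holomorphic on the strip $S_\beta=\{\tau\in\mathbb{C}:|\mathrm{Im}\,\tau|<\beta\}$ and sends $S_\beta$ bijectively onto the open unit disk $\{|\sigma|<1\}$. Let $N\ge 2$, $G>0$, and let $m_1,\dots,m_N\ge 0$ be masses, some of which may vanish, with $M=\sum_i m_i>0$. Let $q^0\in(\mathbb{R}^3)^N$ with $q^0_i\ne q^0_j$ for $i\neq j$, and $v^0\in(\mathbb{R}^3)^N$. The $N$-body equations $$\frac{dq_i}{dt}=v_i,\qquad \frac{dv_i}{dt}=\sum_{j\ne i}\frac{G m_j}{\|q_i-q_j\|^3}(q_j-q_i),\qquad q(0)=q^0,\quad v(0)=v^0,$$ have a maximal (non-extendable, collision-free) solution $(q(t),v(t))$ on an open interval $I\ni 0$. For every such solution put $$s(q,v)=\Big(\sum_{i<j}\frac{\|v_i-v_j\|^2}{\|q_i-q_j\|^2}+\sum_{i<j}\frac{K_i(q)+K_j(q)}{\|q_i-q_j\|}\Big)^{-1/2},\qquad K_i(q)=\sum_{k\neq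 i}\frac{G m_k}{\|q_i-q_k\|^2},$$ and $\theta(t)=\int_0^t s(q(t'),v(t'))^{-1}\,dt'$. Then $\theta$ maps $I$ bijectively onto $\mathbb{R}$, and there are holomorphic functions $\hat q,\hat v:S_\beta\to(\mathbb{C}^3)^N$ and $\hat t:S_\beta\to\mathbb{C}$ with $$\hat q(\theta(t))=q(t),\qquad \hat v(\theta(t))=v(t),\qquad \hat t(\theta(t))=t\qquad(t\in I).$$ Moreover, there are coefficients $a_k,b_k\in(\mathbb{R}^3)^N$ and $c_k\in\mathbb{R}$ $(k\ge 0)$ such that the power series $\sum_k a_k\sigma^k$, $\sum_k b_k\sigma^k$, $\sum_k c_k\sigma^k$ converge for all complex $\sigma$ with $|\sigma|<1$, and $$\hat q(\tau)=\sum_{k\ge0}a_k\,\sigma(\tau)^k,\qquad \hat v(\tau)=\sum_{k\ge0}b_k\,\sigma(\tau)^k,\qquad \hat t(\tau)=\sum_{k\ge0}c_k\,\sigma(\tau)^k\qquad(\tau\in S_\beta).$$ In particular $\beta$ depends neither on $N$, $G$, the initial data nor the masses, and the representation stays valid in the limit $\min_i m_i/M\to 0$, including $\min_i m_i=0$. 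-/

import Mathlib

noncomputable section

namespace NBody

/-- `N` vectors of Euclidean `3`-space over `𝕜` (real or complex). -/
abbrev Config (𝕜 : Type) (N : ℕ) : Type := Fin N → EuclideanSpace 𝕜 (Fin 3)

/-- No two bodies occupy the same position, i.e. `q ∉ Δ`. -/
def NonCollision {N : ℕ} (q : Config ℝ N) : Prop := ∀ i j, i ≠ j → q i ≠ q j

/-- Gravitational acceleration of body `i`. -/
def accel {N : ℕ} (G : ℝ) (m : Fin N → ℝ) (q : Config ℝ N) (i : Fin N) :
    EuclideanSpace ℝ (Fin 3) :=
  ∑ j ∈ Finset.univ.erase i, (G * m j / ‖q i - q j‖ ^ 3) • (q j - q i)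

/-- `(q, v)` solves, on the open interval `I` around `0`, the `N`-body equations
`q_i' = v_i`, `v_i' = ∑_{j ≠ i} G m_j (q_j - q_i) / ‖q_i - q_j‖³` with initial values `(q₀, v₀)`. -/
structure IsSolution {N : ℕ} (G : ℝ) (m : Fin N → ℝ) (q₀ v₀ : Config ℝ N)
    (I : Set ℝ) (q v : ℝ → Config ℝ N) : Prop where
  isOpen : IsOpen I
  ordConnected : I.OrdConnected
  zero_mem : (0 : ℝ) ∈ I
  init_q : q 0 = q₀
  init_v : v 0 = v₀
  nonCollision : ∀ t ∈ I, NonCollision (q t)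
  deriv_q : ∀ t ∈ I, ∀ i, HasDerivAt (fun s => q s i) (v t i) t
  deriv_v : ∀ t ∈ I, ∀ i, HasDerivAt (fun s => v s i) (accel G m (q t) i) t

/-- A solution that cannot be extended to a larger open interval. -/
def IsMaximalSolution {N : ℕ} (G : ℝ) (m : Fin N → ℝ) (q₀ v₀ : Config ℝ N)
    (I : Set ℝ) (q v : ℝ → Config ℝ N) : Prop :=
  IsSolution G m q₀ v₀ I q v ∧
    ∀ (J : Set ℝ) (q' v' : ℝ → Config ℝ N), IsSolution G m q₀ v₀ J q' v' →
      I ⊆ J → Set.EqOn q' q I → Set.EqOn v' v I → J = I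

/-- `K_i(q) = ∑_{j ≠ i} G m_j / ‖q_i - q_j‖²`. -/
def K {N : ℕ} (G : ℝ) (m : Fin N → ℝ) (q : Config ℝ N) (i : Fin N) : ℝ :=
  ∑ j ∈ Finset.univ.erase i, G * m j / ‖q i - q j‖ ^ 2

/-- The time-renormalization function
`s(q, v) = (∑_{i<j} ‖v_i - v_j‖² / ‖q_i - q_j‖² + ∑_{i<j} (K_i + K_j) / ‖q_i - q_j‖)^(-1/2)`. -/
def timeRenorm {N : ℕ} (G : ℝ) (m : Fin N → ℝ) (q v : Config ℝ N) : ℝ :=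
  ((∑ i, ∑ j ∈ Finset.Ioi i, ‖v i - v j‖ ^ 2 / ‖q i - q j‖ ^ 2) +
    ∑ i, ∑ j ∈ Finset.Ioi i, (K G m q i + K G m q j) / ‖q i - q j‖) ^ (-(1 / 2) : ℝ)

/-- The fictitious time `θ(t) = ∫₀ᵗ s(q(t'), v(t'))⁻¹ dt'` along a solution. -/
def fictitiousTime {N : ℕ} (G : ℝ) (m : Fin N → ℝ) (q v : ℝ → Config ℝ N) (t : ℝ) : ℝ :=
  ∫ t' in (0 : ℝ)..t, (timeRenorm G m (q t') (v t'))⁻¹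

/-- The open strip `|Im τ| < β`. -/
def strip (β : ℝ) : Set ℂ := {τ | |τ.im| < β}

/-- `σ(τ) = (exp(πτ/(2β)) - 1) / (exp(πτ/(2β)) + 1)`. -/
def conformalMap (β : ℝ) (τ : ℂ) : ℂ :=
  (Complex.exp (Real.pi / (2 * β) * τ) - 1) / (Complex.exp (Real.pi / (2 * β) * τ) + 1)

/-- The inclusion of `(ℝ³)^N` into `(ℂ³)^N`. -/
def complexify {N : ℕ} (x : Config ℝ N) : Config ℂ N :=
  fun i => WithLp.toLp 2 fun k => ((x i k : ℝ) : ℂ)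

end NBody

end

open Set Filter Topology Metric

namespace NBody

/-! Everything follows from one uniform local fact: in fictitious time the complexified equations
have a holomorphic solution in the disk of radius `0.0444443` about every real collision-free point,
with no dependence on `N`, `G`, the masses or the point (`exists_local_solution`).

The uniformity comes from the choice of `s`. Since `s² * rate = 1` and each pair contributes at most
`rate`, both `s ‖v_i - v_j‖` and `s² (K_i + K_j)` are at most `‖q_i - q_j‖`. The `box` measures
deviations in these natural units. On it the continued terms of `rate` and `K` have small relative
errors, and since the real terms are nonnegative, the errors add up without a factor `N` and without
a lower bound on the masses. Hence the field `F` is analytic on the box, and `x₀ + z F(y)` stays in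
the box for `‖z‖ ≤ 0.0444443` (`add_smul_field_mem_box`). Picard iteration inside this compact
convex set converges on the whole disk (`exists_holomorphic_solution`) and stays real on the real
axis.

Reparametrized by physical time, such a local solution is contained in the maximal one. So the range
of the fictitious time contains an interval of radius `β` around each of its points; it is clopen,
hence all of `ℝ`. The identity theorem glues the disks to a function on the strip. Composition with
the inverse conformal map and Taylor expansion in the unit disk give the series; reality on the axis
makes the coefficients real. -/

/-- The end point of a path lies in a closed convex set if all constant-velocity paths with the
velocities of the given path end there. -/
theorem mem_of_forall_add_deriv_mem {E : Type*} [NormedAddCommGroup E] [NormedSpace ℝ E]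
    [CompleteSpace E] {C : Set E} (hC : Convex ℝ C) (hCc : IsClosed C) {G g : ℝ → E}
    (hG : ∀ s ∈ Icc (0 : ℝ) 1, HasDerivAt G (g s) s) (hg : ContinuousOn g (Icc 0 1))
    (h : ∀ s ∈ Icc (0 : ℝ) 1, G 0 + g s ∈ C) : G 1 ∈ C := by
  have hgi : IntervalIntegrable g MeasureTheory.volume 0 1 :=
    ContinuousOn.intervalIntegrable (by rwa [uIcc_of_le zero_le_one])
  have h1 : ∫ s in (0 : ℝ)..1, g s = G 1 - G 0 :=
    intervalIntegral.integral_eq_sub_of_hasDerivAt (by rwa [uIcc_of_le zero_le_one]) hgi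
  have h2 : ∫ s in (0 : ℝ)..1, (G 0 + g s) = G 1 := by
    rw [intervalIntegral.integral_add (by simp) hgi, h1]
    simp
  rw [intervalIntegral.integral_of_le zero_le_one] at h2
  rw [← h2]
  -- `G 1` is now the mean of `G 0 + g s` over a probability measure, and means of values in a
  -- closed convex set stay in it.
  have : MeasureTheory.IsProbabilityMeasure
      (MeasureTheory.volume.restrict (Ioc (0 : ℝ) 1)) := ⟨by simp⟩
  refine hC.integral_mem hCc ?_ ?_
  · refine (MeasureTheory.ae_restrict_iff' measurableSet_Ioc).2 (Eventually.of_forall ?_)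
    exact fun s hs => h s ⟨hs.1.le, hs.2⟩
  · have : IntervalIntegrable (fun s => G 0 + g s) MeasureTheory.volume 0 1 :=
      IntervalIntegrable.add (by simp) hgi
    exact (intervalIntegrable_iff_integrableOn_Ioc_of_le zero_le_one).1 this

/-! ### Picard iteration in a complex disk -/

section Picard

variable {E : Type*} [NormedAddCommGroup E] [NormedSpace ℂ E] [NormedSpace ℝ E]
  [IsScalarTower ℝ ℂ E]

theorem hasDerivAt_comp_mul_ofReal {G : ℂ → E} {g' : E} {z : ℂ} {s : ℝ}
    (h : HasDerivAt G g' (s * z)) : HasDerivAt (fun s : ℝ => G (s * z)) (z • g') s := by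
  have h1 : HasDerivAt (fun s : ℝ => (s : ℂ) * z) (1 * z) s :=
    (HasDerivAt.ofReal_comp (hasDerivAt_id s)).mul_const z
  have := HasDerivAt.scomp s (h := fun s : ℝ => (s : ℂ) * z) h h1
  rwa [one_mul] at this

theorem ofReal_mul_mem_ball {z : ℂ} {β s : ℝ} (hz : z ∈ ball (0 : ℂ) β) (hs : s ∈ Icc (0 : ℝ) 1) :
    (s : ℂ) * z ∈ ball (0 : ℂ) β := by
  rw [mem_ball_zero_iff] at hz ⊢
  rw [norm_mul, Complex.norm_real, Real.norm_of_nonneg hs.1]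
  exact lt_of_le_of_lt (mul_le_of_le_one_left (norm_nonneg _) hs.2) hz

/-- Two Picard iterates come closer in the norm weighted by `exp (-2 L |z|)`. -/
theorem picard_step_contracts {B : Set E} {F : E → E} {L : NNReal} (hF : LipschitzOnWith L F B)
    {β D : ℝ} (hD : 0 ≤ D) {X X' Y Y' : ℂ → E} (hXB : MapsTo X (ball 0 β) B)
    (hXB' : MapsTo X' (ball 0 β) B) (h0 : Y 0 = Y' 0)
    (hY : ∀ z ∈ ball (0 : ℂ) β, HasDerivAt Y (F (X z)) z)
    (hY' : ∀ z ∈ ball (0 : ℂ) β, HasDerivAt Y' (F (X' z)) z)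
    (h : ∀ z ∈ ball (0 : ℂ) β, ‖X z - X' z‖ ≤ D * Real.exp (2 * L * ‖z‖)) :
    ∀ z ∈ ball (0 : ℂ) β, ‖Y z - Y' z‖ ≤ D / 2 * Real.exp (2 * L * ‖z‖) := by
  intro z hz
  have hd : ∀ s ∈ Icc (0 : ℝ) 1, HasDerivAt (fun s : ℝ => Y (s * z) - Y' (s * z))
      (z • (F (X (s * z)) - F (X' (s * z)))) s := fun s hs => by
    rw [smul_sub]
    exact (hasDerivAt_comp_mul_ofReal (hY _ (ofReal_mul_mem_ball hz hs))).sub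
      (hasDerivAt_comp_mul_ofReal (hY' _ (ofReal_mul_mem_ball hz hs)))
  -- On the ray to `z` the speed of the difference is at most `L ‖z‖ D exp (2 L ‖z‖ s)`, exactly the
  -- derivative of the majorant. The factor `2` in the weight produces the contraction by one half,
  -- so `β` need not be small compared with `1 / L`.
  have key := image_norm_le_of_norm_deriv_right_le_deriv_boundary (a := 0) (b := 1)
    (f := fun s : ℝ => Y (s * z) - Y' (s * z))
    (B := fun s => D / 2 * Real.exp (2 * L * ‖z‖ * s))
    (B' := fun s => D / 2 * (Real.exp (2 * L * ‖z‖ * s) * (2 * L * ‖z‖)))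
    (fun s hs => (hd s hs).continuousAt.continuousWithinAt)
    (fun s hs => (hd s ⟨hs.1, hs.2.le⟩).hasDerivWithinAt) (by simpa [h0] using by positivity)
    (fun s => by
      have := ((hasDerivAt_id s).const_mul (2 * L * ‖z‖)).exp.const_mul (D / 2)
      simpa using this)
    (fun s hs => by
      have hs' : s ∈ Icc (0 : ℝ) 1 := ⟨hs.1, hs.2.le⟩
      have hm := ofReal_mul_mem_ball hz hs'
      have h1 := hF.norm_sub_le (hXB hm) (hXB' hm)
      have h2 := h _ hm
      rw [norm_mul, Complex.norm_real, Real.norm_of_nonneg hs.1] at h2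
      rw [norm_smul]
      calc ‖z‖ * ‖F (X (s * z)) - F (X' (s * z))‖
          ≤ ‖z‖ * (L * (D * Real.exp (2 * L * (s * ‖z‖)))) := by gcongr; exact h1.trans (by gcongr)
        _ = _ := by rw [show 2 * (L : ℝ) * (s * ‖z‖) = 2 * L * ‖z‖ * s by ring]; ring)
    (right_mem_Icc.2 zero_le_one)
  simpa using key

variable [CompleteSpace E]

/-- The averaging principle on the segment from `0` to `z`. It serves both for the compact set and,
with real `z`, for the set of real points. -/
theorem primitive_mem {C : Set E} (hC : Convex ℝ C) (hCc : IsClosed C) {G g : ℂ → E} {β : ℝ}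
    (hG : ∀ z ∈ ball (0 : ℂ) β, HasDerivAt G (g z) z) (hg : ContinuousOn g (ball 0 β)) {z : ℂ}
    (hz : z ∈ ball (0 : ℂ) β) (h : ∀ s ∈ Icc (0 : ℝ) 1, G 0 + z • g (s * z) ∈ C) : G z ∈ C := by
  have := mem_of_forall_add_deriv_mem hC hCc (G := fun s : ℝ => G (s * z))
    (g := fun s : ℝ => z • g (s * z))
    (fun s hs => hasDerivAt_comp_mul_ofReal (hG _ (ofReal_mul_mem_ball hz hs)))
    (ContinuousOn.const_smul (hg.comp (by fun_prop) fun s hs => ofReal_mul_mem_ball hz hs) z)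
    (by simpa using h)
  simpa using this

/-- A step of the Picard iteration in the disk of radius `β`: `Y` is the function with `Y 0 = x₀`
and derivative `F ∘ X`. The closed convex set `B` is kept, and so is `S` on the real axis. -/
theorem exists_picard_step {B S : Set E} (hBc : IsClosed B) (hB : Convex ℝ B) (hSc : IsClosed S)
    (hS : Convex ℝ S) {F : E → E} (hF : ∀ y ∈ B, DifferentiableAt ℂ F y) {x₀ : E} {β : ℝ}
    (hFB : ∀ z ∈ ball (0 : ℂ) β, ∀ y ∈ B, x₀ + z • F y ∈ B)
    (hFS : ∀ r : ℝ, ∀ y ∈ B ∩ S, x₀ + (r : ℂ) • F y ∈ S) {X : ℂ → E}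
    (hX : DifferentiableOn ℂ X (ball 0 β)) (hXB : MapsTo X (ball 0 β) B)
    (hXS : ∀ r : ℝ, (r : ℂ) ∈ ball (0 : ℂ) β → X r ∈ S) :
    ∃ Y : ℂ → E, Y 0 = x₀ ∧ (∀ z ∈ ball (0 : ℂ) β, HasDerivAt Y (F (X z)) z) ∧
      MapsTo Y (ball 0 β) B ∧ ∀ r : ℝ, (r : ℂ) ∈ ball (0 : ℂ) β → Y r ∈ S := by
  have hFX : DifferentiableOn ℂ (fun z => F (X z)) (ball 0 β) := fun z hz =>
    (hF _ (hXB hz)).comp_differentiableWithinAt z (hX z hz)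
  obtain ⟨Y, hY0, hY⟩ := hFX.isExactOn_ball.with_val_at 0 x₀
  refine ⟨Y, hY0, hY, fun z hz => ?_, fun r hr => ?_⟩
  · exact primitive_mem hB hBc hY hFX.continuousOn hz fun s hs =>
      hY0 ▸ hFB z hz _ (hXB (ofReal_mul_mem_ball hz hs))
  · refine primitive_mem hS hSc hY hFX.continuousOn hr fun s hs => ?_
    have h := ofReal_mul_mem_ball hr hs
    have h' : ((s * r : ℝ) : ℂ) ∈ ball (0 : ℂ) β := by simpa using h
    rw [hY0]
    refine hFS r _ ⟨hXB h, ?_⟩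
    simpa using hXS _ h'

/-- Existence of a holomorphic solution of `X' = F(X)`, `X(0) = x₀` in a disk, if a compact convex
set `B` contains all `x₀ + z F(y)`. -/
theorem exists_holomorphic_solution {B S : Set E} (hBk : IsCompact B) (hB : Convex ℝ B)
    (hSc : IsClosed S) (hS : Convex ℝ S) {F : E → E} (hF : ∀ y ∈ B, ContDiffAt ℂ 1 F y) {x₀ : E}
    {β : ℝ} (hx₀ : x₀ ∈ B ∩ S) (hFB : ∀ z ∈ ball (0 : ℂ) β, ∀ y ∈ B, x₀ + z • F y ∈ B)
    (hFS : ∀ r : ℝ, ∀ y ∈ B ∩ S, x₀ + (r : ℂ) • F y ∈ S) (hβ : 0 < β) :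
    ∃ X : ℂ → E, X 0 = x₀ ∧ (∀ z ∈ ball (0 : ℂ) β, HasDerivAt X (F (X z)) z) ∧
      MapsTo X (ball 0 β) B ∧ ∀ r : ℝ, (r : ℂ) ∈ ball (0 : ℂ) β → X r ∈ S := by
  have hFd : ∀ y ∈ B, DifferentiableAt ℂ F y := fun y hy => (hF y hy).differentiableAt one_ne_zero
  -- Compactness gives one Lipschitz constant; its size never enters the radius.
  obtain ⟨L, hL⟩ : ∃ L, LipschitzOnWith L F B := by
    refine LocallyLipschitzOn.exists_lipschitzOnWith_of_compact hBk fun y hy => ?_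
    obtain ⟨K, t, ht, h⟩ := (hF y hy).exists_lipschitzOnWith
    exact ⟨K, t, mem_nhdsWithin_of_mem_nhds ht, h⟩
  obtain ⟨R, hR⟩ := hBk.isBounded.exists_norm_le
  have hR0 : 0 ≤ R := (norm_nonneg _).trans (hR x₀ hx₀.1)
  -- The invariants are bundled in a subtype so that the Picard step becomes a self-map that can be
  -- iterated.
  let P : (ℂ → E) → Prop := fun X => X 0 = x₀ ∧ DifferentiableOn ℂ X (ball 0 β) ∧
    MapsTo X (ball 0 β) B ∧ ∀ r : ℝ, (r : ℂ) ∈ ball (0 : ℂ) β → X r ∈ S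
  have hstep : ∀ X : {X // P X}, ∃ Y : {X // P X},
      ∀ z ∈ ball (0 : ℂ) β, HasDerivAt Y.1 (F (X.1 z)) z := fun ⟨X, h0, h1, h2, h3⟩ => by
    obtain ⟨Y, hY0, hY, hYB, hYS⟩ := exists_picard_step hBk.isClosed hB hSc hS hFd hFB hFS h1 h2 h3
    exact ⟨⟨Y, hY0, fun z hz => (hY z hz).differentiableAt.differentiableWithinAt, hYB, hYS⟩, hY⟩
  choose Φ hΦ using hstep
  let X : ℕ → {X // P X} := fun n => Φ^[n] ⟨fun _ => x₀, rfl, by fun_prop, fun _ _ => hx₀.1,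
    fun _ _ => hx₀.2⟩
  have hXs : ∀ n, ∀ z ∈ ball (0 : ℂ) β, HasDerivAt (X (n + 1)).1 (F ((X n).1 z)) z := fun n => by
    have : X (n + 1) = Φ (X n) := Function.iterate_succ_apply' _ _ _
    rw [this]
    exact hΦ _
  have hdist : ∀ n, ∀ z ∈ ball (0 : ℂ) β,
      ‖(X (n + 1)).1 z - (X n).1 z‖ ≤ 2 * R * (1 / 2) ^ n * Real.exp (2 * L * ‖z‖) := by
    intro n
    induction n with
    | zero =>
      intro z hz
      have h1 := hR _ ((X 1).2.2.2.1 hz)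
      have h2 := hR _ ((X 0).2.2.2.1 hz)
      have h3 : 1 ≤ Real.exp (2 * L * ‖z‖) := Real.one_le_exp (by positivity)
      calc _ ≤ ‖(X 1).1 z‖ + ‖(X 0).1 z‖ := norm_sub_le _ _
        _ ≤ 2 * R * 1 := by linarith
        _ ≤ 2 * R * Real.exp (2 * L * ‖z‖) := mul_le_mul_of_nonneg_left h3 (by positivity)
        _ = _ := by rw [pow_zero, mul_one]
    | succ n ih =>
      have := picard_step_contracts hL (D := 2 * R * (1 / 2) ^ n) (by positivity)
        (X (n + 1)).2.2.2.1 (X n).2.2.2.1 ((X (n + 2)).2.1.trans (X (n + 1)).2.1.symm)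
        (hXs (n + 1)) (hXs n) ih
      intro z hz
      refine (this z hz).trans (le_of_eq ?_)
      ring
  set C : ℝ := 2 * R * Real.exp (2 * L * β) with hC
  have hgeo : ∀ z ∈ ball (0 : ℂ) β, ∀ n,
      dist ((X n).1 z) ((X (n + 1)).1 z) ≤ C * (1 / 2) ^ n := fun z hz n => by
    rw [dist_comm, dist_eq_norm]
    refine (hdist n z hz).trans ?_
    have : ‖z‖ ≤ β := (mem_ball_zero_iff.1 hz).le
    calc _ ≤ 2 * R * (1 / 2) ^ n * Real.exp (2 * L * β) := by gcongr
      _ = _ := by rw [hC]; ring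
  have hlim : ∀ z, ∃ x, z ∈ ball (0 : ℂ) β → Tendsto (fun n => (X n).1 z) atTop (𝓝 x) := fun z => by
    by_cases hz : z ∈ ball (0 : ℂ) β
    · obtain ⟨x, hx⟩ := cauchySeq_tendsto_of_complete
        (cauchySeq_of_le_geometric _ _ (by norm_num) (hgeo z hz))
      exact ⟨x, fun _ => hx⟩
    · exact ⟨0, fun h => absurd h hz⟩
  choose Z hZ using hlim
  have hunif : TendstoUniformlyOn (fun n => (X n).1) Z atTop (ball 0 β) := by
    rw [Metric.tendstoUniformlyOn_iff]
    intro ε hε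
    have : Tendsto (fun n : ℕ => C * (1 / 2 : ℝ) ^ n / (1 - 1 / 2)) atTop (𝓝 0) := by
      have := ((tendsto_pow_atTop_nhds_zero_of_lt_one (r := (1 / 2 : ℝ)) (by norm_num)
        (by norm_num)).const_mul C).div_const (1 - 1 / 2)
      simpa using this
    filter_upwards [this.eventually (gt_mem_nhds hε)] with n hn z hz
    rw [dist_comm]
    exact (dist_le_of_le_geometric_of_tendsto _ _ (by norm_num) (hgeo z hz) (hZ z hz) n).trans_lt hn
  have hZB : MapsTo Z (ball 0 β) B := fun z hz =>
    hBk.isClosed.mem_of_tendsto (hZ z hz) (Eventually.of_forall fun n => (X n).2.2.2.1 hz)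
  have hXd : ∀ᶠ n in atTop, DifferentiableOn ℂ (X n).1 (ball 0 β) :=
    Eventually.of_forall fun n => (X n).2.2.1
  have hZd := hunif.tendstoLocallyUniformlyOn.differentiableOn hXd isOpen_ball
  refine ⟨Z, ?_, fun z hz => ?_, hZB, fun r hr =>
    hSc.mem_of_tendsto (hZ r hr) (Eventually.of_forall fun n => (X n).2.2.2.2 r hr)⟩
  · exact tendsto_nhds_unique (hZ 0 (mem_ball_self hβ))
      (tendsto_const_nhds.congr fun n => (X n).2.1.symm)
  -- Derivatives of uniformly convergent holomorphic functions converge too, so `X_{n+1}' = F(X_n)`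
  -- passes to the limit.
  · have h1 := ((hunif.tendstoLocallyUniformlyOn.deriv hXd isOpen_ball).tendsto_at hz)
    have h2 := h1.comp (tendsto_add_atTop_nat 1)
    have h3 : Tendsto (fun n => F ((X n).1 z)) atTop (𝓝 (F (Z z))) :=
      (hFd _ (hZB hz)).continuousAt.tendsto.comp (hZ z hz)
    have h4 : deriv Z z = F (Z z) := tendsto_nhds_unique h2
      (h3.congr fun n => ((hXs n z hz).deriv).symm)
    rw [← h4]
    exact (hZd.differentiableAt (isOpen_ball.mem_nhds hz)).hasDerivAt

end Picard

/-! ### The conformal map from the strip onto the unit disk -/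

/-- The inverse `σ ↦ (2β/π) log ((1 + σ) / (1 - σ))` of the conformal map. -/
noncomputable def conformalMapInv (β : ℝ) (σ : ℂ) : ℂ :=
  2 * β / Real.pi * Complex.log ((1 + σ) / (1 - σ))

theorem re_exp_pos_of_mem_strip {β : ℝ} (hβ : 0 < β) {τ : ℂ} (hτ : τ ∈ strip β) :
    0 < (Complex.exp (Real.pi / (2 * β) * τ)).re ∧
      |(Real.pi / (2 * β) * τ : ℂ).im| < Real.pi / 2 := by
  have him : (Real.pi / (2 * β) * τ : ℂ).im = Real.pi / (2 * β) * τ.im := by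
    have : (Real.pi / (2 * β) * τ : ℂ) = ((Real.pi / (2 * β) : ℝ) : ℂ) * τ := by push_cast; rfl
    rw [this, Complex.im_ofReal_mul]
  have hτ' : |τ.im| < β := hτ
  have hlt : |(Real.pi / (2 * β) * τ : ℂ).im| < Real.pi / 2 := by
    rw [him, abs_mul, abs_of_pos (by positivity)]
    calc Real.pi / (2 * β) * |τ.im| < Real.pi / (2 * β) * β := by gcongr
      _ = Real.pi / 2 := by field_simp
  refine ⟨?_, hlt⟩
  rw [Complex.exp_re]
  exact mul_pos (Real.exp_pos _) (Real.cos_pos_of_mem_Ioo (abs_lt.1 hlt))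

/-- The right half-plane consists of the points closer to `1` than to `-1`. Both directions are
needed, for the Cayley map and its inverse. -/
theorem norm_sub_one_lt_norm_add_one_iff {w : ℂ} : ‖w - 1‖ < ‖w + 1‖ ↔ 0 < w.re := by
  rw [← sq_lt_sq₀ (norm_nonneg _) (norm_nonneg _), ← Complex.normSq_eq_norm_sq,
    ← Complex.normSq_eq_norm_sq, Complex.normSq_apply, Complex.normSq_apply]
  simp only [Complex.sub_re, Complex.add_re, Complex.one_re, Complex.sub_im, Complex.add_im,
    Complex.one_im]
  constructor <;> intro h <;> nlinarith

theorem ne_zero_of_re_pos {w : ℂ} (h : 0 < w.re) : w ≠ 0 := by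
  rintro rfl
  simp at h

theorem add_one_ne_zero_of_re_pos {w : ℂ} (h : 0 < w.re) : w + 1 ≠ 0 :=
  ne_zero_of_re_pos (by simp only [Complex.add_re, Complex.one_re]; linarith)

theorem one_sub_ne_zero_of_mem_ball {σ : ℂ} (hσ : σ ∈ ball (0 : ℂ) 1) : 1 - σ ≠ 0 := by
  intro h
  rw [← sub_eq_zero.1 h] at hσ
  simp at hσ

theorem re_cayley_pos {σ : ℂ} (hσ : σ ∈ ball (0 : ℂ) 1) : 0 < ((1 + σ) / (1 - σ)).re := by
  have h1 := one_sub_ne_zero_of_mem_ball hσ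
  rw [← norm_sub_one_lt_norm_add_one_iff]
  have e1 : (1 + σ) / (1 - σ) - 1 = 2 / (1 - σ) * σ := by field_simp; ring
  have e2 : (1 + σ) / (1 - σ) + 1 = 2 / (1 - σ) := by field_simp; ring
  rw [e1, e2, norm_mul]
  have h2 : 0 < ‖2 / (1 - σ)‖ := norm_pos_iff.2 (div_ne_zero two_ne_zero h1)
  exact mul_lt_of_lt_one_right h2 (mem_ball_zero_iff.1 hσ)

theorem conformalMap_mem_ball {β : ℝ} (hβ : 0 < β) {τ : ℂ} (hτ : τ ∈ strip β) :
    conformalMap β τ ∈ ball (0 : ℂ) 1 := by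
  have h := (re_exp_pos_of_mem_strip hβ hτ).1
  rw [mem_ball_zero_iff, conformalMap, norm_div,
    div_lt_one (norm_pos_iff.2 (add_one_ne_zero_of_re_pos h))]
  exact norm_sub_one_lt_norm_add_one_iff.2 h

theorem conformalMapInv_conformalMap {β : ℝ} (hβ : 0 < β) {τ : ℂ} (hτ : τ ∈ strip β) :
    conformalMapInv β (conformalMap β τ) = τ := by
  obtain ⟨h, him⟩ := re_exp_pos_of_mem_strip hβ hτ
  have h1 := add_one_ne_zero_of_re_pos h
  have hpi : (Real.pi : ℂ) ≠ 0 := by exact_mod_cast Real.pi_ne_zero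
  have hβ' : (β : ℂ) ≠ 0 := by exact_mod_cast hβ.ne'
  have h2 : (1 + conformalMap β τ) / (1 - conformalMap β τ) =
      Complex.exp (Real.pi / (2 * β) * τ) := by
    have h3 := one_sub_ne_zero_of_mem_ball (conformalMap_mem_ball hβ hτ)
    rw [div_eq_iff h3]
    rw [conformalMap]
    generalize Complex.exp (Real.pi / (2 * β) * τ) = w at h1
    field_simp
    ring
  -- An imaginary part below `π / 2` in absolute value lies where the principal logarithm inverts
  -- `exp`.
  have := abs_lt.1 him
  rw [conformalMapInv, h2, Complex.log_exp (by linarith [Real.pi_pos]) (by linarith [Real.pi_pos])]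
  field_simp

theorem conformalMapInv_mem_strip {β : ℝ} (hβ : 0 < β) {σ : ℂ} (hσ : σ ∈ ball (0 : ℂ) 1) :
    conformalMapInv β σ ∈ strip β := by
  have h := re_cayley_pos hσ
  have him : (conformalMapInv β σ).im = 2 * β / Real.pi * ((1 + σ) / (1 - σ)).arg := by
    have : conformalMapInv β σ =
        ((2 * β / Real.pi : ℝ) : ℂ) * Complex.log ((1 + σ) / (1 - σ)) := by
      rw [conformalMapInv]; push_cast; rfl
    rw [this, Complex.im_ofReal_mul, Complex.log_im]
  have harg := Complex.abs_arg_lt_pi_div_two_iff.2 (Or.inl h)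
  have hpi := Real.pi_pos
  change |_| < β
  rw [him, abs_mul, abs_of_pos (by positivity)]
  calc 2 * β / Real.pi * |((1 + σ) / (1 - σ)).arg| < 2 * β / Real.pi * (Real.pi / 2) := by gcongr
    _ = β := by field_simp

theorem conformalMap_conformalMapInv {β : ℝ} (hβ : 0 < β) {σ : ℂ} (hσ : σ ∈ ball (0 : ℂ) 1) :
    conformalMap β (conformalMapInv β σ) = σ := by
  have h := re_cayley_pos hσ
  have h1 := one_sub_ne_zero_of_mem_ball hσ
  have hpi : (Real.pi : ℂ) ≠ 0 := by exact_mod_cast Real.pi_ne_zero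
  have hβ' : (β : ℂ) ≠ 0 := by exact_mod_cast hβ.ne'
  have e : (Real.pi / (2 * β) * conformalMapInv β σ : ℂ) = Complex.log ((1 + σ) / (1 - σ)) := by
    rw [conformalMapInv]; field_simp
  rw [conformalMap, e, Complex.exp_log (ne_zero_of_re_pos h),
    div_eq_iff (add_one_ne_zero_of_re_pos h)]
  field_simp
  ring

theorem differentiableOn_conformalMap {β : ℝ} (hβ : 0 < β) :
    DifferentiableOn ℂ (conformalMap β) (strip β) := by
  intro τ hτ
  have h := add_one_ne_zero_of_re_pos (re_exp_pos_of_mem_strip hβ hτ).1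
  unfold conformalMap
  exact DifferentiableWithinAt.div (by fun_prop) (by fun_prop) h

theorem differentiableOn_conformalMapInv (β : ℝ) :
    DifferentiableOn ℂ (conformalMapInv β) (ball 0 1) := by
  intro σ hσ
  unfold conformalMapInv
  have h : DifferentiableWithinAt ℂ (fun σ : ℂ => (1 + σ) / (1 - σ)) (ball 0 1) σ :=
    DifferentiableWithinAt.div (by fun_prop) (by fun_prop) (one_sub_ne_zero_of_mem_ball hσ)
  exact (h.clog (Or.inl (re_cayley_pos hσ))).const_mul _

theorem bijOn_conformalMap {β : ℝ} (hβ : 0 < β) :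
    BijOn (conformalMap β) (strip β) (ball (0 : ℂ) 1) :=
  InvOn.bijOn (f' := conformalMapInv β)
    ⟨fun _ h => conformalMapInv_conformalMap hβ h, fun _ h => conformalMap_conformalMapInv hβ h⟩
    (fun _ h => conformalMap_mem_ball hβ h) fun _ h => conformalMapInv_mem_strip hβ h

/-- Carries reality on the axis of the strip over to the real diameter of the disk, as the real
Taylor coefficients require. -/
theorem conformalMapInv_ofReal (β : ℝ) {r : ℝ} (hr : (r : ℂ) ∈ ball (0 : ℂ) 1) :
    ∃ x : ℝ, conformalMapInv β r = x := by
  have hr' : |r| < 1 := by simpa using hr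
  have := abs_lt.1 hr'
  refine ⟨2 * β / Real.pi * Real.log ((1 + r) / (1 - r)), ?_⟩
  rw [conformalMapInv]
  push_cast
  rw [Complex.ofReal_log (div_nonneg (by linarith) (by linarith))]
  push_cast
  rfl

/-! ### Gluing along the real axis, and real power series -/

section Holomorphic

variable {E : Type*} [NormedAddCommGroup E] [NormedSpace ℂ E] [CompleteSpace E]

/-- Holomorphic functions that agree on the real points of a connected open set are equal. -/
theorem eqOn_of_eq_on_real {U : Set ℂ} (hU : IsOpen U) (hUc : IsPreconnected U) {m : ℝ}
    (hm : (m : ℂ) ∈ U) {f g : ℂ → E} (hf : DifferentiableOn ℂ f U) (hg : DifferentiableOn ℂ g U)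
    (h : ∀ r : ℝ, (r : ℂ) ∈ U → f r = g r) : EqOn f g U := by
  refine (hf.analyticOnNhd hU).eqOn_of_preconnected_of_frequently_eq (hg.analyticOnNhd hU) hUc hm ?_
  have ht : Tendsto (fun r : ℝ => (r : ℂ)) (𝓝[≠] m) (𝓝[≠] (m : ℂ)) :=
    tendsto_nhdsWithin_iff.2 ⟨Complex.continuous_ofReal.continuousAt.tendsto.mono_left
      nhdsWithin_le_nhds, eventually_nhdsWithin_of_forall fun r hr => by simpa using hr⟩
  have he : ∀ᶠ r : ℝ in 𝓝[≠] m, f r = g r :=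
    Eventually.mono (mem_nhdsWithin_of_mem_nhds
      ((hU.preimage Complex.continuous_ofReal).mem_nhds hm)) h
  exact ht.frequently he.frequently

/-- A curve that extends holomorphically to all disks of radius `β` with real centers extends
to the strip. -/
theorem exists_holomorphic_extension_strip {β : ℝ} {h : ℝ → E}
    (hloc : ∀ x : ℝ, ∃ X : ℂ → E, DifferentiableOn ℂ X (ball (x : ℂ) β) ∧
      ∀ r : ℝ, (r : ℂ) ∈ ball (x : ℂ) β → X r = h r) (hβ : 0 < β) :
    ∃ H : ℂ → E, DifferentiableOn ℂ H (strip β) ∧ ∀ r : ℝ, H r = h r := by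
  choose X hX hXh using hloc
  -- Each point takes its value from the disk centered at its real part. Near `τ₀` this choice
  -- agrees with the single function `X τ₀.re`, which gives differentiability.
  refine ⟨fun τ => X τ.re τ, fun τ₀ hτ₀ => ?_, fun r => hXh r r (mem_ball_self hβ)⟩
  have hmem : ∀ {τ : ℂ}, τ ∈ strip β → τ ∈ ball (τ.re : ℂ) β := fun {τ} hτ => by
    rw [mem_ball, Complex.dist_of_re_eq (by simp)]
    have h : |τ.im| < β := hτ
    simpa [Real.dist_eq] using h
  have hopen : IsOpen (strip β) := isOpen_lt (by fun_prop) continuous_const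
  have hev : ∀ᶠ τ in 𝓝 τ₀, X τ.re τ = X τ₀.re τ := by
    filter_upwards [hopen.mem_nhds hτ₀, isOpen_ball.mem_nhds (hmem hτ₀)] with τ h1 h2
    have hre : |τ.re - τ₀.re| < β := by
      have := Complex.abs_re_le_norm (τ - τ₀.re)
      rw [mem_ball, dist_eq_norm] at h2
      simpa using this.trans_lt h2
    have hlt := abs_lt.1 hre
    -- The overlap of the two disks is convex and contains the midpoint of their centers, a real
    -- point at which the identity theorem applies.
    refine eqOn_of_eq_on_real (U := ball (τ.re : ℂ) β ∩ ball (τ₀.re : ℂ) β)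
      (isOpen_ball.inter isOpen_ball)
      ((convex_ball _ _).inter (convex_ball _ _)).isPreconnected
      (m := (τ.re + τ₀.re) / 2) ?_ ((hX _).mono inter_subset_left) ((hX _).mono inter_subset_right)
      (fun r hr => (hXh _ _ hr.1).trans (hXh _ _ hr.2).symm) ⟨hmem h1, h2⟩
    constructor <;>
    · rw [mem_ball, Complex.dist_eq, ← Complex.ofReal_sub, Complex.norm_real, Real.norm_eq_abs,
        abs_lt]
      constructor <;> linarith
  have hd : DifferentiableAt ℂ (X τ₀.re) τ₀ :=
    (hX _).differentiableAt (isOpen_ball.mem_nhds (hmem hτ₀))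
  exact (hd.congr_of_eventuallyEq hev).differentiableWithinAt

variable [NormedSpace ℝ E] [IsScalarTower ℝ ℂ E]

/-- At a real point the complex derivative is a limit of difference quotients along the axis, which
lie in the closed real subspace. So the derivative inherits the hypothesis and induction applies. -/
theorem iteratedDeriv_mem_of_real {S : Submodule ℝ E} (hS : IsClosed (S : Set E)) {ρ : ℝ}
    (hρ : 0 < ρ) (n : ℕ) {f : ℂ → E} (hf : DifferentiableOn ℂ f (ball 0 ρ))
    (hfS : ∀ r : ℝ, (r : ℂ) ∈ ball (0 : ℂ) ρ → f r ∈ S) : iteratedDeriv n f 0 ∈ S := by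
  induction n generalizing f with
  | zero => simpa using hfS 0 (by simpa using hρ)
  | succ n ih =>
    rw [iteratedDeriv_succ']
    refine ih (hf.deriv isOpen_ball) fun r hr => ?_
    have h1 := (hf.differentiableAt (isOpen_ball.mem_nhds hr)).hasDerivAt
    have h2 := h1.scomp r (h := fun s : ℝ => (s : ℂ)) Complex.ofRealCLM.hasDerivAt
    rw [Complex.ofRealCLM_apply, Complex.ofReal_one, one_smul] at h2
    refine hS.mem_of_tendsto (hasDerivAt_iff_tendsto_slope.1 h2) ?_
    have : ∀ᶠ s : ℝ in 𝓝[≠] r, (s : ℂ) ∈ ball (0 : ℂ) ρ := mem_nhdsWithin_of_mem_nhds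
      ((isOpen_ball.preimage Complex.continuous_ofReal).mem_nhds hr)
    filter_upwards [this] with s hs
    exact S.smul_mem _ (S.sub_mem (hfS s hs) (hfS r hr))

/-- A holomorphic function on the strip that is real on the real axis is a power series in `σ(τ)`
with real coefficients, convergent in the unit disk. -/
theorem exists_powerSeries_conformalMap {β : ℝ} (hβ : 0 < β) {S : Submodule ℝ E}
    (hS : IsClosed (S : Set E)) {H : ℂ → E} (hH : DifferentiableOn ℂ H (strip β))
    (hHS : ∀ r : ℝ, H r ∈ S) :
    ∃ (Q : ℂ → E) (a : ℕ → E), (∀ k, a k ∈ S) ∧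
      (∀ σ ∈ ball (0 : ℂ) 1, HasSum (fun k => σ ^ k • a k) (Q σ)) ∧
      ∀ τ ∈ strip β, H τ = Q (conformalMap β τ) := by
  have hQ : DifferentiableOn ℂ (fun σ => H (conformalMapInv β σ)) (ball 0 1) :=
    hH.comp (differentiableOn_conformalMapInv β) fun σ hσ => conformalMapInv_mem_strip hβ hσ
  refine ⟨fun σ => H (conformalMapInv β σ), fun k => ((k.factorial : ℝ)⁻¹) •
    iteratedDeriv k (fun σ => H (conformalMapInv β σ)) 0, fun k => ?_, fun σ hσ => ?_,
    fun τ hτ => ?_⟩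
  · refine S.smul_mem _ (iteratedDeriv_mem_of_real hS zero_lt_one k hQ fun r hr => ?_)
    obtain ⟨x, hx⟩ := conformalMapInv_ofReal β hr
    rw [hx]
    exact hHS x
  -- The Taylor series converges on the whole disk of holomorphy, so no coefficient estimate is
  -- needed.
  · convert Complex.hasSum_taylorSeries_on_ball hQ hσ using 2 with k
    beta_reduce
    rw [sub_zero, ← algebraMap_smul ℂ ((k.factorial : ℝ)⁻¹), smul_comm]
    simp
  · change H τ = H (conformalMapInv β (conformalMap β τ))
    rw [conformalMapInv_conformalMap hβ hτ]

end Holomorphic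

/-! ### The complexified vector field -/

/-- The complex-bilinear square `∑ x_k²`. -/
noncomputable def bsq (x : EuclideanSpace ℂ (Fin 3)) : ℂ := ∑ k, x k * x k

/-- The inclusion of `ℝ³` into `ℂ³`. -/
noncomputable def ofRealVec (x : EuclideanSpace ℝ (Fin 3)) : EuclideanSpace ℂ (Fin 3) :=
  WithLp.toLp 2 fun k => ((x k : ℝ) : ℂ)

theorem complexify_apply {N : ℕ} (q : Config ℝ N) (i : Fin N) :
    complexify q i = ofRealVec (q i) := rfl

@[simp] theorem ofRealVec_apply (x : EuclideanSpace ℝ (Fin 3)) (k : Fin 3) :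
    ofRealVec x k = (x k : ℂ) := rfl

theorem ofRealVec_sub (x y : EuclideanSpace ℝ (Fin 3)) :
    ofRealVec x - ofRealVec y = ofRealVec (x - y) := by
  ext k; simp

theorem norm_ofRealVec (x : EuclideanSpace ℝ (Fin 3)) : ‖ofRealVec x‖ = ‖x‖ := by
  simp [EuclideanSpace.norm_eq]

theorem bsq_ofRealVec (x : EuclideanSpace ℝ (Fin 3)) : bsq (ofRealVec x) = ((‖x‖ ^ 2 : ℝ) : ℂ) := by
  rw [EuclideanSpace.real_norm_sq_eq]
  simp [bsq, sq]

theorem norm_bilin_le (x y : EuclideanSpace ℂ (Fin 3)) : ‖∑ k, x k * y k‖ ≤ ‖x‖ * ‖y‖ := by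
  rw [EuclideanSpace.norm_eq, EuclideanSpace.norm_eq]
  refine (norm_sum_le _ _).trans ?_
  simp only [norm_mul]
  exact Real.sum_mul_le_sqrt_mul_sqrt _ _ _

/-- Expand around `y` and use Cauchy–Schwarz. The bilinear square is holomorphic but has nontrivial
zeros on `ℂ³`; only closeness to a real vector keeps it away from `0`. -/
theorem norm_bsq_sub_le (x y : EuclideanSpace ℂ (Fin 3)) :
    ‖bsq x - bsq y‖ ≤ ‖x - y‖ * (‖x - y‖ + 2 * ‖y‖) := by
  have h : bsq x - bsq y = (∑ k, (x - y) k * (x - y) k) + 2 * ∑ k, (x - y) k * y k := by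
    rw [bsq, bsq, ← Finset.sum_sub_distrib, Finset.mul_sum, ← Finset.sum_add_distrib]
    refine Finset.sum_congr rfl fun k _ => ?_
    simp only [PiLp.sub_apply]
    ring
  rw [h]
  refine (norm_add_le _ _).trans ?_
  rw [norm_mul, Complex.norm_two, mul_add]
  have h1 := norm_bilin_le (x - y) (x - y)
  have h2 := norm_bilin_le (x - y) y
  linarith

section Field

variable {N : ℕ} (G : ℝ) (m : Fin N → ℝ)

/-- The holomorphic continuation of `1 / ‖q_i - q_j‖`. -/
noncomputable def invDist (q : Config ℂ N) (i j : Fin N) : ℂ :=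
  bsq (q i - q j) ^ (-(1 / 2) : ℂ)

/-- The holomorphic continuation of `K`. -/
noncomputable def cK (q : Config ℂ N) (i : Fin N) : ℂ :=
  ∑ j ∈ Finset.univ.erase i, (G * m j : ℂ) * invDist q i j ^ 2

/-- The holomorphic continuation of `accel`. -/
noncomputable def cAccel (q : Config ℂ N) : Config ℂ N := fun i =>
  ∑ j ∈ Finset.univ.erase i, ((G * m j : ℂ) * invDist q i j ^ 3) • (q j - q i)

/-- The expression under the power `-1/2` in `timeRenorm`. -/
noncomputable def rate (q v : Config ℝ N) : ℝ :=
  (∑ i, ∑ j ∈ Finset.Ioi i, ‖v i - v j‖ ^ 2 / ‖q i - q j‖ ^ 2) +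
    ∑ i, ∑ j ∈ Finset.Ioi i, (K G m q i + K G m q j) / ‖q i - q j‖

/-- The holomorphic continuation of `rate`. -/
noncomputable def cRate (q v : Config ℂ N) : ℂ :=
  (∑ i, ∑ j ∈ Finset.Ioi i, bsq (v i - v j) * invDist q i j ^ 2) +
    ∑ i, ∑ j ∈ Finset.Ioi i, (cK G m q i + cK G m q j) * invDist q i j

/-- The holomorphic continuation of `timeRenorm`. -/
noncomputable def cTimeRenorm (q v : Config ℂ N) : ℂ := cRate G m q v ^ (-(1 / 2) : ℂ)

/-- The complexified phase space, with physical time as an additional coordinate. -/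
abbrev Phase (N : ℕ) : Type := Config ℂ N × Config ℂ N × ℂ

/-- The vector field of the `N`-body problem in fictitious time. -/
noncomputable def field (x : Phase N) : Phase N :=
  (cTimeRenorm G m x.1 x.2.1 • x.2.1, cTimeRenorm G m x.1 x.2.1 • cAccel G m x.1,
    cTimeRenorm G m x.1 x.2.1)

theorem timeRenorm_eq (q v : Config ℝ N) : timeRenorm G m q v = rate G m q v ^ (-(1 / 2) : ℝ) := rfl

/-! Values at real points. -/

theorem invDist_complexify (q : Config ℝ N) (i j : Fin N) :
    invDist (complexify q) i j = ((‖q i - q j‖⁻¹ : ℝ) : ℂ) := by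
  rw [invDist, complexify_apply, complexify_apply, ofRealVec_sub, bsq_ofRealVec]
  have : (-(1 / 2) : ℂ) = ((-(1 / 2) : ℝ) : ℂ) := by push_cast; rfl
  rw [this, ← Complex.ofReal_cpow (by positivity), ← Real.rpow_natCast, ← Real.rpow_mul (by positivity),
    ← Real.rpow_neg_one]
  norm_num

theorem cK_complexify (q : Config ℝ N) (i : Fin N) :
    cK G m (complexify q) i = (K G m q i : ℂ) := by
  simp only [cK, K, invDist_complexify]
  push_cast
  refine Finset.sum_congr rfl fun j _ => ?_
  rw [inv_pow, div_eq_mul_inv]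

theorem cAccel_complexify (q : Config ℝ N) :
    cAccel G m (complexify q) = complexify (accel G m q) := by
  funext i
  ext k
  simp only [cAccel, accel, invDist_complexify, complexify_apply, ofRealVec_sub]
  simp [div_eq_mul_inv]

theorem cRate_complexify (q v : Config ℝ N) :
    cRate G m (complexify q) (complexify v) = (rate G m q v : ℂ) := by
  simp only [cRate, rate, invDist_complexify, cK_complexify, complexify_apply, ofRealVec_sub,
    bsq_ofRealVec, div_eq_mul_inv]
  push_cast
  simp only [inv_pow]

theorem K_nonneg {G : ℝ} {m : Fin N → ℝ} (hG : 0 < G) (hm : ∀ i, 0 ≤ m i) (q : Config ℝ N)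
    (i : Fin N) : 0 ≤ K G m q i :=
  Finset.sum_nonneg fun j _ => div_nonneg (mul_nonneg hG.le (hm j)) (by positivity)

/-- A body of positive mass makes `K` positive at every other body, so any pair containing it
contributes. One nonzero mass suffices. -/
theorem rate_pos {G : ℝ} {m : Fin N → ℝ} (hN : 2 ≤ N) (hG : 0 < G) (hm : ∀ i, 0 ≤ m i)
    (hM : 0 < ∑ i, m i) {q : Config ℝ N} (hq : NonCollision q) (v : Config ℝ N) :
    0 < rate G m q v := by
  have hKn := K_nonneg hG hm q
  obtain ⟨k, -, hk⟩ : ∃ k ∈ Finset.univ, 0 < m k := by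
    by_contra! h
    exact absurd (Finset.sum_nonpos h) (not_le.2 hM)
  have hterm : ∀ i j, 0 ≤ (K G m q i + K G m q j) / ‖q i - q j‖ := fun i j =>
    div_nonneg (add_nonneg (hKn i) (hKn j)) (norm_nonneg _)
  have hpair : ∃ i j, i < j ∧ (i = k ∨ j = k) := by
    have : Nontrivial (Fin N) := Fin.nontrivial_iff_two_le.2 hN
    obtain ⟨l, hl⟩ := exists_ne k
    rcases lt_or_gt_of_ne hl with h | h
    · exact ⟨l, k, h, Or.inr rfl⟩
    · exact ⟨k, l, h, Or.inl rfl⟩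
  have hKpos : ∀ i, i ≠ k → 0 < K G m q i := fun i hi =>
    Finset.sum_pos' (fun j _ => div_nonneg (mul_nonneg hG.le (hm j)) (by positivity))
      ⟨k, Finset.mem_erase.2 ⟨hi.symm, Finset.mem_univ _⟩,
        div_pos (mul_pos hG hk) (pow_pos (norm_pos_iff.2 (sub_ne_zero.2 (hq i k hi))) 2)⟩
  obtain ⟨i, j, hij, hk'⟩ := hpair
  refine add_pos_of_nonneg_of_pos (Finset.sum_nonneg fun i _ => Finset.sum_nonneg fun j _ => by
    positivity) ?_
  refine Finset.sum_pos' (fun i _ => Finset.sum_nonneg fun j _ => hterm i j)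
    ⟨i, Finset.mem_univ _, Finset.sum_pos' (fun j _ => hterm i j)
      ⟨j, Finset.mem_Ioi.2 hij, div_pos ?_ (norm_pos_iff.2 (sub_ne_zero.2 (hq i j hij.ne)))⟩⟩
  rcases hk' with rfl | rfl
  · exact add_pos_of_nonneg_of_pos (hKn _) (hKpos j hij.ne')
  · exact add_pos_of_pos_of_nonneg (hKpos i hij.ne) (hKn _)

theorem cTimeRenorm_complexify {q v : Config ℝ N} (h : 0 ≤ rate G m q v) :
    cTimeRenorm G m (complexify q) (complexify v) = (timeRenorm G m q v : ℂ) := by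
  have : (-(1 / 2) : ℂ) = ((-(1 / 2) : ℝ) : ℂ) := by push_cast; rfl
  rw [cTimeRenorm, cRate_complexify, this, ← Complex.ofReal_cpow h, timeRenorm_eq]

theorem field_complexify {q v : Config ℝ N} (h : 0 ≤ rate G m q v) (t : ℂ) :
    field G m (complexify q, complexify v, t) =
      (complexify (timeRenorm G m q v • v), complexify (timeRenorm G m q v • accel G m q),
        (timeRenorm G m q v : ℂ)) := by
  rw [field]
  simp only [cTimeRenorm_complexify G m h, cAccel_complexify]
  refine Prod.ext ?_ (Prod.ext ?_ rfl) <;>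
  · funext i
    ext k
    simp [complexify_apply]

/-! Analyticity. -/

/-- Positive real parts keep all bases in the slit plane, where the principal powers are analytic.
-/
theorem analyticAt_field {x : Phase N} (h : ∀ i j, i ≠ j → 0 < (bsq (x.1 i - x.1 j)).re)
    (hA : 0 < (cRate G m x.1 x.2.1).re) : AnalyticAt ℂ (field G m) x := by
  have hfst : AnalyticAt ℂ (fun x : Phase N => x.1) x := analyticAt_fst
  have hsnd : AnalyticAt ℂ (fun x : Phase N => x.2.1) x := analyticAt_fst.comp analyticAt_snd
  have hq : ∀ i, AnalyticAt ℂ (fun x : Phase N => x.1 i) x := fun i =>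
    ((ContinuousLinearMap.proj (R := ℂ) (φ := fun _ : Fin N => EuclideanSpace ℂ (Fin 3))
      i).analyticAt _).comp hfst
  have hv : ∀ i, AnalyticAt ℂ (fun x : Phase N => x.2.1 i) x := fun i =>
    ((ContinuousLinearMap.proj (R := ℂ) (φ := fun _ : Fin N => EuclideanSpace ℂ (Fin 3))
      i).analyticAt _).comp hsnd
  have hb : ∀ {f : Phase N → EuclideanSpace ℂ (Fin 3)}, AnalyticAt ℂ f x →
      AnalyticAt ℂ (fun x => bsq (f x)) x := fun {f} hf => by
    have hk : ∀ k, AnalyticAt ℂ (fun x => f x k) x := fun k =>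
      ((EuclideanSpace.proj (𝕜 := ℂ) k).analyticAt (f x)).comp hf
    exact Finset.analyticAt_fun_sum _ fun k _ => (hk k).mul (hk k)
  have hi : ∀ i j, i ≠ j → AnalyticAt ℂ (fun x : Phase N => invDist x.1 i j) x := fun i j hij =>
    (hb ((hq i).sub (hq j))).cpow analyticAt_const (Or.inl (h i j hij))
  have hK : ∀ i, AnalyticAt ℂ (fun x : Phase N => cK G m x.1 i) x := fun i =>
    Finset.analyticAt_fun_sum _ fun j hj =>
      analyticAt_const.mul ((hi i j (Finset.ne_of_mem_erase hj).symm).pow 2)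
  have hR : AnalyticAt ℂ (fun x : Phase N => cRate G m x.1 x.2.1) x := by
    refine AnalyticAt.add ?_ ?_ <;>
      refine Finset.analyticAt_fun_sum _ fun i _ => Finset.analyticAt_fun_sum _ fun j hj => ?_
    · exact (hb ((hv i).sub (hv j))).mul ((hi i j (Finset.mem_Ioi.1 hj).ne).pow 2)
    · exact ((hK i).add (hK j)).mul (hi i j (Finset.mem_Ioi.1 hj).ne)
  have hs : AnalyticAt ℂ (fun x : Phase N => cTimeRenorm G m x.1 x.2.1) x :=
    hR.cpow analyticAt_const (Or.inl hA)
  have ha : AnalyticAt ℂ (fun x : Phase N => cAccel G m x.1) x :=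
    AnalyticAt.pi fun i => Finset.analyticAt_fun_sum _ fun j hj =>
      (analyticAt_const.mul ((hi i j (Finset.ne_of_mem_erase hj).symm).pow 3)).smul
        ((hq j).sub (hq i))
  exact (hs.smul hsnd).prod ((hs.smul ha).prod hs)

end Field

/-! ### A box on which the complexified field is controlled -/

theorem sq_cpow_neg_half_mul {z : ℂ} (hz : z ≠ 0) : z * (z ^ (-(1 / 2) : ℂ)) ^ 2 = 1 := by
  rw [← Complex.cpow_nat_mul]
  norm_num [Complex.cpow_neg_one, hz]

/-- The principal branch halves the argument. This sign later selects the inverse root near `1`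
rather than the one near `-1`. -/
theorem re_cpow_neg_half_nonneg (z : ℂ) : 0 ≤ (z ^ (-(1 / 2) : ℂ)).re := by
  rcases eq_or_ne z 0 with rfl | hz
  · simp
  rw [Complex.cpow_def_of_ne_zero hz, Complex.exp_re]
  refine mul_nonneg (Real.exp_pos _).le (Real.cos_nonneg_of_mem_Icc ?_)
  have h : (Complex.log z * (-(1 / 2))).im = -(z.arg / 2) := by
    have : (-(1 / 2) : ℂ) = ((-(1 / 2) : ℝ) : ℂ) := by push_cast; rfl
    rw [this, Complex.im_mul_ofReal, Complex.log_im]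
    ring
  rw [h]
  constructor <;> linarith [Complex.neg_pi_lt_arg z, Complex.arg_le_pi z]

/-- Bounds for the inverse square root of a number close to `1`. -/
theorem inv_sqrt_bounds {w u : ℂ} (h : w * u ^ 2 = 1) (hu : 0 ≤ u.re) (hw : ‖w - 1‖ ≤ 0.1236) :
    ‖u ^ 2‖ ≤ 1.1411 ∧ ‖u ^ 2 - 1‖ ≤ 0.1411 ∧ ‖u - 1‖ ≤ 0.076 ∧ ‖u‖ ≤ 1.076 := by
  have h1 : ‖w‖ * ‖u ^ 2‖ = 1 := by rw [← norm_mul, h, norm_one]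
  have h2 : 0.8764 ≤ ‖w‖ := by
    have := norm_sub_norm_le (1 : ℂ) (1 - w)
    rw [sub_sub_cancel, norm_one, norm_sub_rev] at this
    linarith
  have h3 : ‖u ^ 2‖ ≤ 1.1411 := by nlinarith [norm_nonneg (u ^ 2)]
  have h4 : ‖u ^ 2 - 1‖ ≤ 0.14105 := by
    have : u ^ 2 - 1 = -((w - 1) * u ^ 2) := by rw [sub_mul, h]; ring
    rw [this, norm_neg, norm_mul]
    calc _ ≤ (0.1236 : ℝ) * 1.1411 := by gcongr
      _ ≤ _ := by norm_num
  have h5 : ‖u - 1‖ * ‖u + 1‖ ≤ 0.14105 := by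
    rw [← norm_mul]
    convert h4 using 2
    ring
  have h6 : u.re + 1 ≤ ‖u + 1‖ := by simpa using Complex.re_le_norm (u + 1)
  have h7 : 1 - u.re ≤ ‖u - 1‖ := by
    rw [norm_sub_rev]
    simpa using Complex.re_le_norm (1 - u)
  -- A bootstrap: `‖u + 1‖ ≥ 1` gives a crude bound; then `‖u + 1‖ ≥ 2 - ‖u - 1‖ ≥ 1.85895` improves
  -- it to `0.076`.
  have h8 : ‖u - 1‖ ≤ 0.14105 := by nlinarith [norm_nonneg (u - 1)]
  have h9 : ‖u - 1‖ ≤ 0.076 := by nlinarith [norm_nonneg (u - 1)]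
  refine ⟨h3, by linarith, h9, ?_⟩
  calc ‖u‖ = ‖(u - 1) + 1‖ := by rw [sub_add_cancel]
    _ ≤ ‖u - 1‖ + ‖(1 : ℂ)‖ := norm_add_le _ _
    _ ≤ _ := by rw [norm_one]; linarith

section Box

variable {N : ℕ} (G : ℝ) (m : Fin N → ℝ) (q₀ v₀ : Config ℝ N) (t₀ : ℝ)

/-- The points at bounded distance from a real point, relative to the scales of that point. -/
def box : Set (Phase N) :=
  -- The two relative conditions carry the estimates, with constants tuned to close the invariance
  -- argument. The three absolute ones make the set bounded, hence compact, and have ample room.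
  {x | (∀ i j, i ≠ j →
      ‖(x.1 i - x.1 j) - ofRealVec (q₀ i - q₀ j)‖ ≤ 0.06 * ‖q₀ i - q₀ j‖) ∧
    (∀ i j, i ≠ j → ‖(x.2.1 i - x.2.1 j) - ofRealVec (v₀ i - v₀ j)‖ ≤
      0.071 * (timeRenorm G m q₀ v₀ * (K G m q₀ i + K G m q₀ j))) ∧
    (∀ i, ‖x.1 i - ofRealVec (q₀ i)‖ ≤
      timeRenorm G m q₀ v₀ * (‖v₀ i‖ + timeRenorm G m q₀ v₀ * K G m q₀ i)) ∧
    (∀ i, ‖x.2.1 i - ofRealVec (v₀ i)‖ ≤ timeRenorm G m q₀ v₀ * K G m q₀ i) ∧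
    ‖x.2.2 - t₀‖ ≤ timeRenorm G m q₀ v₀}

variable {G m q₀ v₀ t₀}

theorem isClosed_box : IsClosed (box G m q₀ v₀ t₀) := by
  have hc : ∀ i, Continuous fun x : Phase N => x.1 i := fun i => (continuous_apply i).comp continuous_fst
  have hc' : ∀ i, Continuous fun x : Phase N => x.2.1 i := fun i =>
    (continuous_apply i).comp (continuous_fst.comp continuous_snd)
  simp only [box, ofPred_and, ofPred_forall]
  refine ((isClosed_iInter fun i => isClosed_iInter fun j => isClosed_iInter fun _ =>
    isClosed_le (((hc i).sub (hc j)).sub continuous_const).norm continuous_const).inter ?_)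
  refine ((isClosed_iInter fun i => isClosed_iInter fun j => isClosed_iInter fun _ =>
    isClosed_le (((hc' i).sub (hc' j)).sub continuous_const).norm continuous_const).inter ?_)
  refine (isClosed_iInter fun i => isClosed_le ((hc i).sub continuous_const).norm
    continuous_const).inter ?_
  refine (isClosed_iInter fun i => isClosed_le ((hc' i).sub continuous_const).norm
    continuous_const).inter ?_
  exact isClosed_le (by fun_prop) continuous_const

theorem isCompact_box : IsCompact (box G m q₀ v₀ t₀) := by
  refine IsCompact.of_isClosed_subset (((isCompact_univ_pi fun i : Fin N =>
    isCompact_closedBall (ofRealVec (q₀ i))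
      (timeRenorm G m q₀ v₀ * (‖v₀ i‖ + timeRenorm G m q₀ v₀ * K G m q₀ i)))).prod
    ((isCompact_univ_pi fun i : Fin N => isCompact_closedBall (ofRealVec (v₀ i))
      (timeRenorm G m q₀ v₀ * K G m q₀ i)).prod
      (isCompact_closedBall (t₀ : ℂ) (timeRenorm G m q₀ v₀)))) isClosed_box fun x hx => ?_
  obtain ⟨-, -, h1, h2, h3⟩ := hx
  exact ⟨fun i _ => mem_closedBall_iff_norm.2 (h1 i), fun i _ => mem_closedBall_iff_norm.2 (h2 i),
    mem_closedBall_iff_norm.2 h3⟩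

theorem convex_box : Convex ℝ (box G m q₀ v₀ t₀) := by
  have key : ∀ {F : Type} [NormedAddCommGroup F] [NormedSpace ℝ F] {p p' c e : F} {d a b : ℝ},
      ‖p - c‖ ≤ d → ‖p' - c‖ ≤ d → 0 ≤ a → 0 ≤ b → a + b = 1 → e = a • p + b • p' →
      ‖e - c‖ ≤ d := fun {F} _ _ {p p' c e d a b} h h' ha hb hab he => by
    have := convex_closedBall c d (mem_closedBall_iff_norm.2 h) (mem_closedBall_iff_norm.2 h')
      ha hb hab
    rw [he]
    exact mem_closedBall_iff_norm.1 this
  rintro x ⟨h1, h2, h3, h4, h5⟩ y ⟨k1, k2, k3, k4, k5⟩ a b ha hb hab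
  refine ⟨fun i j hij => key (h1 i j hij) (k1 i j hij) ha hb hab ?_,
    fun i j hij => key (h2 i j hij) (k2 i j hij) ha hb hab ?_,
    fun i => key (h3 i) (k3 i) ha hb hab ?_, fun i => key (h4 i) (k4 i) ha hb hab ?_,
    key h5 k5 ha hb hab ?_⟩
  · simp only [Prod.fst_add, Prod.smul_fst, Pi.add_apply, Pi.smul_apply]
    module
  · simp only [Prod.fst_add, Prod.smul_fst, Prod.snd_add, Prod.smul_snd, Pi.add_apply,
      Pi.smul_apply]
    module
  · rfl
  · rfl
  · rfl

/-- The point of phase space given by real positions and velocities and a real time. -/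
noncomputable def ofRealPhase (q v : Config ℝ N) (t : ℝ) : Phase N :=
  (complexify q, complexify v, (t : ℂ))

theorem timeRenorm_pos (h : 0 < rate G m q₀ v₀) : 0 < timeRenorm G m q₀ v₀ := by
  rw [timeRenorm_eq]
  positivity

theorem sq_timeRenorm_mul_rate (h : 0 < rate G m q₀ v₀) :
    timeRenorm G m q₀ v₀ ^ 2 * rate G m q₀ v₀ = 1 := by
  rw [timeRenorm_eq, ← Real.rpow_natCast, ← Real.rpow_mul h.le]
  norm_num [Real.rpow_neg_one]
  field_simp

theorem center_mem_box (hK : ∀ i, 0 ≤ K G m q₀ i) (h : 0 < rate G m q₀ v₀) :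
    ofRealPhase q₀ v₀ t₀ ∈ box G m q₀ v₀ t₀ := by
  have hs := timeRenorm_pos h
  refine ⟨fun i j _ => ?_, fun i j _ => ?_, fun i => ?_, fun i => ?_, ?_⟩
  · simp only [ofRealPhase, complexify_apply, ofRealVec_sub, sub_self, norm_zero]
    positivity
  · simp only [ofRealPhase, complexify_apply, ofRealVec_sub, sub_self, norm_zero]
    have := hK i
    have := hK j
    positivity
  · simp only [ofRealPhase, complexify_apply, sub_self, norm_zero]
    have := hK i
    positivity
  · simp only [ofRealPhase, complexify_apply, sub_self, norm_zero]
    have := hK i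
    positivity
  · simpa [ofRealPhase] using hs.le

end Box

/-! ### Estimates on the box and its invariance -/

section Estimates

variable {N : ℕ} {G : ℝ} {m : Fin N → ℝ} {q₀ v₀ : Config ℝ N} {t₀ : ℝ} {x : Phase N}

theorem norm_bsq_sub_le_of_mem_box (hx : x ∈ box G m q₀ v₀ t₀) {i j : Fin N} (hij : i ≠ j) :
    ‖bsq (x.1 i - x.1 j) - ((‖q₀ i - q₀ j‖ ^ 2 : ℝ) : ℂ)‖ ≤ 0.1236 * ‖q₀ i - q₀ j‖ ^ 2 := by
  have h := hx.1 i j hij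
  have h1 := norm_bsq_sub_le (x.1 i - x.1 j) (ofRealVec (q₀ i - q₀ j))
  rw [bsq_ofRealVec, norm_ofRealVec] at h1
  calc _ ≤ _ := h1
    _ ≤ (0.06 * ‖q₀ i - q₀ j‖) * (0.06 * ‖q₀ i - q₀ j‖ + 2 * ‖q₀ i - q₀ j‖) := by gcongr
    _ = _ := by ring

theorem re_bsq_pos_of_mem_box (hq : NonCollision q₀) (hx : x ∈ box G m q₀ v₀ t₀) {i j : Fin N}
    (hij : i ≠ j) : 0 < (bsq (x.1 i - x.1 j)).re := by
  have h := norm_bsq_sub_le_of_mem_box hx hij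
  have hr : 0 < ‖q₀ i - q₀ j‖ ^ 2 := pow_pos (norm_pos_iff.2 (sub_ne_zero.2 (hq i j hij))) 2
  have h1 := (Complex.re_le_norm (((‖q₀ i - q₀ j‖ ^ 2 : ℝ) : ℂ) - bsq (x.1 i - x.1 j)))
  rw [norm_sub_rev _ (bsq _), Complex.sub_re, Complex.ofReal_re] at h1
  linarith

/-- On the box, `invDist` times the distance at the center is close to `1`. -/
theorem invDist_mul_bounds (hq : NonCollision q₀) (hx : x ∈ box G m q₀ v₀ t₀) {i j : Fin N}
    (hij : i ≠ j) : ∃ u : ℂ, invDist x.1 i j = u * ((‖q₀ i - q₀ j‖⁻¹ : ℝ) : ℂ) ∧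
      ‖u ^ 2‖ ≤ 1.1411 ∧ ‖u ^ 2 - 1‖ ≤ 0.1411 ∧ ‖u - 1‖ ≤ 0.076 ∧ ‖u‖ ≤ 1.076 := by
  have h := norm_bsq_sub_le_of_mem_box hx hij
  have hb := ne_zero_of_re_pos (re_bsq_pos_of_mem_box hq hx hij)
  have hr : 0 < ‖q₀ i - q₀ j‖ := norm_pos_iff.2 (sub_ne_zero.2 (hq i j hij))
  set r := ‖q₀ i - q₀ j‖
  set b := bsq (x.1 i - x.1 j)
  have hrc : (r : ℂ) ≠ 0 := by exact_mod_cast hr.ne'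
  refine ⟨invDist x.1 i j * r, ?_, inv_sqrt_bounds (w := b / (r ^ 2 : ℝ)) ?_ ?_ ?_⟩
  · push_cast
    field_simp
  · have := sq_cpow_neg_half_mul hb
    change b * invDist x.1 i j ^ 2 = 1 at this
    push_cast
    field_simp
    exact this
  · rw [Complex.re_mul_ofReal]
    exact mul_nonneg (re_cpow_neg_half_nonneg _) hr.le
  · have hr2 : ((r ^ 2 : ℝ) : ℂ) ≠ 0 := by exact_mod_cast (pow_pos hr 2).ne'
    rw [div_sub_one hr2, norm_div, Complex.norm_real, Real.norm_of_nonneg (by positivity),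
      div_le_iff₀ (by positivity)]
    exact h

theorem sub_sq_mul_le {u w : ℂ} (hu : ‖u ^ 2 - 1‖ ≤ 0.1411) (hw : ‖w - 1‖ ≤ 0.076)
    (hw' : ‖w‖ ≤ 1.076) : ‖u ^ 2 * w - 1‖ ≤ 0.2279 := by
  calc ‖u ^ 2 * w - 1‖ = ‖(u ^ 2 - 1) * w + (w - 1)‖ := by ring_nf
    _ ≤ ‖u ^ 2 - 1‖ * ‖w‖ + ‖w - 1‖ := by rw [← norm_mul]; exact norm_add_le _ _
    _ ≤ 0.1411 * 1.076 + 0.076 := by gcongr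
    _ ≤ _ := by norm_num

/-- Each summand is its real value times some `u ^ 2 * w` close to `1`. The weights are nonnegative,
so the relative error survives summation. -/
theorem norm_cK_mul_invDist_sub_le (hG : 0 < G) (hm : ∀ i, 0 ≤ m i) (hq : NonCollision q₀)
    (hx : x ∈ box G m q₀ v₀ t₀) (l : Fin N) {i j : Fin N} (hij : i ≠ j) :
    ‖cK G m x.1 l * invDist x.1 i j - ((K G m q₀ l / ‖q₀ i - q₀ j‖ : ℝ) : ℂ)‖ ≤
      0.2279 * (K G m q₀ l / ‖q₀ i - q₀ j‖) := by
  obtain ⟨w, hw, -, -, hw1, hw2⟩ := invDist_mul_bounds hq hx hij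
  have e : cK G m x.1 l * invDist x.1 i j - ((K G m q₀ l / ‖q₀ i - q₀ j‖ : ℝ) : ℂ) =
      ∑ k ∈ Finset.univ.erase l, ((G * m k : ℂ) * invDist x.1 l k ^ 2 * invDist x.1 i j -
        ((G * m k / ‖q₀ l - q₀ k‖ ^ 2 / ‖q₀ i - q₀ j‖ : ℝ) : ℂ)) := by
    rw [cK, K, Finset.sum_mul, Finset.sum_div, Finset.sum_sub_distrib, Complex.ofReal_sum]
  rw [e, K, Finset.sum_div, Finset.mul_sum]
  refine norm_sum_le_of_le _ fun k hk => ?_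
  obtain ⟨u, hu, -, hu1, -, -⟩ := invDist_mul_bounds hq hx (Finset.ne_of_mem_erase hk).symm
  have h0 : 0 ≤ G * m k / ‖q₀ l - q₀ k‖ ^ 2 / ‖q₀ i - q₀ j‖ :=
    div_nonneg (div_nonneg (mul_nonneg hG.le (hm k)) (by positivity)) (norm_nonneg _)
  have e2 : (G * m k : ℂ) * invDist x.1 l k ^ 2 * invDist x.1 i j -
      ((G * m k / ‖q₀ l - q₀ k‖ ^ 2 / ‖q₀ i - q₀ j‖ : ℝ) : ℂ) =
      (u ^ 2 * w - 1) * ((G * m k / ‖q₀ l - q₀ k‖ ^ 2 / ‖q₀ i - q₀ j‖ : ℝ) : ℂ) := by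
    rw [hu, hw]
    push_cast
    simp only [div_eq_mul_inv, mul_pow, inv_pow]
    ring
  rw [e2, norm_mul, Complex.norm_real, Real.norm_of_nonneg h0]
  exact mul_le_mul_of_nonneg_right (sub_sq_mul_le hu1 hw1 hw2) h0

/-- All terms of `rate` are nonnegative. Together with `s² * rate = 1` this bounds each pair
separately, independently of `N`. -/
theorem pair_le_rate (hK : ∀ i, 0 ≤ K G m q₀ i) {i j : Fin N} (hij : i ≠ j) :
    ‖v₀ i - v₀ j‖ ^ 2 / ‖q₀ i - q₀ j‖ ^ 2 + (K G m q₀ i + K G m q₀ j) / ‖q₀ i - q₀ j‖ ≤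
      rate G m q₀ v₀ := by
  have h2 : ∀ i j, 0 ≤ (K G m q₀ i + K G m q₀ j) / ‖q₀ i - q₀ j‖ := fun i j =>
    div_nonneg (add_nonneg (hK i) (hK j)) (norm_nonneg _)
  have main : ∀ {f : Fin N → Fin N → ℝ}, (∀ i j, 0 ≤ f i j) → ∀ {i j}, i < j →
      f i j ≤ ∑ i, ∑ j ∈ Finset.Ioi i, f i j := fun {f} hf {i j} hij =>
    (Finset.single_le_sum (f := fun j => f i j) (fun j _ => hf i j) (Finset.mem_Ioi.2 hij)).trans
      (Finset.single_le_sum (f := fun i => ∑ j ∈ Finset.Ioi i, f i j)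
        (fun i _ => Finset.sum_nonneg fun j _ => hf i j) (Finset.mem_univ i))
  have key : ∀ {i j}, i < j →
      ‖v₀ i - v₀ j‖ ^ 2 / ‖q₀ i - q₀ j‖ ^ 2 + (K G m q₀ i + K G m q₀ j) / ‖q₀ i - q₀ j‖ ≤
      rate G m q₀ v₀ := fun {i j} h =>
    add_le_add (main (f := fun i j => ‖v₀ i - v₀ j‖ ^ 2 / ‖q₀ i - q₀ j‖ ^ 2)
      (fun i j => by positivity) h)
      (main (f := fun i j => (K G m q₀ i + K G m q₀ j) / ‖q₀ i - q₀ j‖) h2 h)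
  rcases lt_or_gt_of_ne hij with h | h
  · exact key h
  · have := key h
    rwa [norm_sub_rev (v₀ j), norm_sub_rev (q₀ j), add_comm (K G m q₀ j)] at this

/-- The kinetic terms of `cRate` on the box. -/
theorem norm_bsq_mul_invDist_sq_sub_le (hK : ∀ i, 0 ≤ K G m q₀ i) (hr : 0 < rate G m q₀ v₀)
    (hq : NonCollision q₀) (hx : x ∈ box G m q₀ v₀ t₀) {i j : Fin N} (hij : i ≠ j) :
    ‖bsq (x.2.1 i - x.2.1 j) * invDist x.1 i j ^ 2 -
      ((‖v₀ i - v₀ j‖ ^ 2 / ‖q₀ i - q₀ j‖ ^ 2 : ℝ) : ℂ)‖ ≤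
      0.2222 * (‖v₀ i - v₀ j‖ ^ 2 / ‖q₀ i - q₀ j‖ ^ 2) +
      0.0869 * ((K G m q₀ i + K G m q₀ j) / ‖q₀ i - q₀ j‖) := by
  obtain ⟨u, hu, hu1, hu2, -, -⟩ := invDist_mul_bounds hq hx hij
  have hv := hx.2.1 i j hij
  have hb := norm_bsq_sub_le (x.2.1 i - x.2.1 j) (ofRealVec (v₀ i - v₀ j))
  rw [bsq_ofRealVec, norm_ofRealVec] at hb
  have hs := timeRenorm_pos hr
  have hsA := sq_timeRenorm_mul_rate hr
  have hle := pair_le_rate (v₀ := v₀) hK hij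
  have hd : 0 < ‖q₀ i - q₀ j‖ := norm_pos_iff.2 (sub_ne_zero.2 (hq i j hij))
  have hk : 0 ≤ K G m q₀ i + K G m q₀ j := add_nonneg (hK i) (hK j)
  set s := timeRenorm G m q₀ v₀
  set A := rate G m q₀ v₀
  set d := ‖q₀ i - q₀ j‖
  set n := ‖v₀ i - v₀ j‖
  set k := K G m q₀ i + K G m q₀ j
  set b := bsq (x.2.1 i - x.2.1 j)
  set w := ‖(x.2.1 i - x.2.1 j) - ofRealVec (v₀ i - v₀ j)‖
  have hw0 : 0 ≤ w := norm_nonneg _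
  have hn0 : 0 ≤ n := norm_nonneg _
  have e : b * invDist x.1 i j ^ 2 - ((n ^ 2 / d ^ 2 : ℝ) : ℂ) =
      ((b - (n ^ 2 : ℝ)) * u ^ 2 + (n ^ 2 : ℝ) * (u ^ 2 - 1)) * (((d ^ 2)⁻¹ : ℝ) : ℂ) := by
    rw [hu]
    push_cast
    simp only [div_eq_mul_inv, mul_pow, inv_pow]
    ring
  have h1 : ‖(b - (n ^ 2 : ℝ)) * u ^ 2 + (n ^ 2 : ℝ) * (u ^ 2 - 1)‖ ≤
      w * (w + 2 * n) * 1.1411 + n ^ 2 * 0.1411 := by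
    refine (norm_add_le _ _).trans ?_
    rw [norm_mul, norm_mul, Complex.norm_real, Real.norm_of_nonneg (by positivity)]
    gcongr
  rw [e, norm_mul, Complex.norm_real, Real.norm_of_nonneg (by positivity)]
  have hy : s ^ 2 * (k / d) ≤ 1 := by
    rw [← hsA]
    gcongr
    exact (le_add_of_nonneg_left (by positivity)).trans hle
  -- With `w ≤ 0.071 s k` and `s² k ≤ d`, the square is absorbed by `k d`; the cross term `2 (s k)
  -- n` is split between `k d` and `n ^ 2` by the arithmetic-geometric mean inequality.
  have h2 : w * (w + 2 * n) ≤ 0.071 * (1.071 * (k * d) + n ^ 2) := by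
    have hsk : (s * k) ^ 2 ≤ k * d := by
      have : s ^ 2 * k ≤ d := by
        rw [← mul_div_assoc, div_le_one hd] at hy
        exact hy
      nlinarith
    have h3 : 2 * (s * k) * n ≤ k * d + n ^ 2 := by nlinarith [sq_nonneg (s * k - n)]
    have hsk0 : 0 ≤ s * k := by positivity
    calc w * (w + 2 * n) ≤ 0.071 * (s * k) * (0.071 * (s * k) + 2 * n) := by gcongr
      _ = 0.071 * (0.071 * (s * k) ^ 2 + 2 * (s * k) * n) := by ring
      _ ≤ 0.071 * (0.071 * (k * d) + (k * d + n ^ 2)) := by gcongr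
      _ = _ := by ring
  have hkd : 0 ≤ k * d := by positivity
  calc _ ≤ (w * (w + 2 * n) * 1.1411 + n ^ 2 * 0.1411) * (d ^ 2)⁻¹ := by gcongr
    _ ≤ (0.2222 * n ^ 2 + 0.0869 * (k * d)) * (d ^ 2)⁻¹ := by
      refine mul_le_mul_of_nonneg_right ?_ (by positivity)
      -- `0.071 * 1.1411 + 0.1411 < 0.2222` and `0.071 * 1.071 * 1.1411 < 0.0869`.
      nlinarith [sq_nonneg n]
    _ = _ := by field_simp

/-- The kinetic terms pass an error `0.0869` on to the potential terms, whose total is `0.0869 +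
0.2279 = 0.3148`; this also dominates the kinetic share `0.2222`. -/
theorem norm_cRate_sub_le (hG : 0 < G) (hm : ∀ i, 0 ≤ m i) (hr : 0 < rate G m q₀ v₀)
    (hq : NonCollision q₀) (hx : x ∈ box G m q₀ v₀ t₀) :
    ‖cRate G m x.1 x.2.1 - (rate G m q₀ v₀ : ℂ)‖ ≤ 0.3148 * rate G m q₀ v₀ := by
  have hK := K_nonneg hG hm q₀
  set X : Fin N → Fin N → ℝ := fun i j => ‖v₀ i - v₀ j‖ ^ 2 / ‖q₀ i - q₀ j‖ ^ 2 with hX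
  set Y : Fin N → Fin N → ℝ := fun i j => (K G m q₀ i + K G m q₀ j) / ‖q₀ i - q₀ j‖ with hY
  have e : cRate G m x.1 x.2.1 - (rate G m q₀ v₀ : ℂ) =
      (∑ i, ∑ j ∈ Finset.Ioi i, (bsq (x.2.1 i - x.2.1 j) * invDist x.1 i j ^ 2 - (X i j : ℂ))) +
      ∑ i, ∑ j ∈ Finset.Ioi i, ((cK G m x.1 i + cK G m x.1 j) * invDist x.1 i j - (Y i j : ℂ)) := by
    simp only [cRate, rate, Finset.sum_sub_distrib, hX, hY]
    push_cast
    ring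
  have e' : rate G m q₀ v₀ = (∑ i, ∑ j ∈ Finset.Ioi i, X i j) + ∑ i, ∑ j ∈ Finset.Ioi i, Y i j :=
    rfl
  have h1 : ∀ i, ∀ j ∈ Finset.Ioi i,
      ‖bsq (x.2.1 i - x.2.1 j) * invDist x.1 i j ^ 2 - (X i j : ℂ)‖ ≤
      0.2222 * X i j + 0.0869 * Y i j := fun i j hj =>
    norm_bsq_mul_invDist_sq_sub_le hK hr hq hx (Finset.mem_Ioi.1 hj).ne
  have h2 : ∀ i, ∀ j ∈ Finset.Ioi i,
      ‖(cK G m x.1 i + cK G m x.1 j) * invDist x.1 i j - (Y i j : ℂ)‖ ≤ 0.2279 * Y i j :=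
    fun i j hj => by
    have hij := (Finset.mem_Ioi.1 hj).ne
    have a1 := norm_cK_mul_invDist_sub_le hG hm hq hx i hij
    have a2 := norm_cK_mul_invDist_sub_le hG hm hq hx j hij
    simp only [hY, add_div, add_mul, mul_add]
    refine le_trans (le_of_eq ?_) ((norm_add_le _ _).trans (add_le_add a1 a2))
    push_cast
    ring_nf
  rw [e]
  have s1 := norm_sum_le_of_le Finset.univ fun i _ => norm_sum_le_of_le _ (h1 i)
  have s2 := norm_sum_le_of_le Finset.univ fun i _ => norm_sum_le_of_le _ (h2 i)
  simp only [Finset.sum_add_distrib, ← Finset.mul_sum] at s1 s2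
  have hXn : 0 ≤ ∑ i, ∑ j ∈ Finset.Ioi i, X i j :=
    Finset.sum_nonneg fun i _ => Finset.sum_nonneg fun j _ => by positivity
  refine (norm_add_le _ _).trans ((add_le_add s1 s2).trans ?_)
  rw [e']
  linarith

theorem re_cRate_pos_of_mem_box (hG : 0 < G) (hm : ∀ i, 0 ≤ m i) (hr : 0 < rate G m q₀ v₀)
    (hq : NonCollision q₀) (hx : x ∈ box G m q₀ v₀ t₀) : 0 < (cRate G m x.1 x.2.1).re := by
  have h := norm_cRate_sub_le hG hm hr hq hx
  have h1 := Complex.re_le_norm ((rate G m q₀ v₀ : ℂ) - cRate G m x.1 x.2.1)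
  rw [norm_sub_rev, Complex.sub_re, Complex.ofReal_re] at h1
  linarith

/-- The square of the inverse root times the rate is `1`, both on the box and at the center; `0.6852
= 1 - 0.3148` and `1.2081 ^ 2 * 0.6852 > 1`. -/
theorem norm_cTimeRenorm_le (hG : 0 < G) (hm : ∀ i, 0 ≤ m i) (hr : 0 < rate G m q₀ v₀)
    (hq : NonCollision q₀) (hx : x ∈ box G m q₀ v₀ t₀) :
    ‖cTimeRenorm G m x.1 x.2.1‖ ≤ 1.2081 * timeRenorm G m q₀ v₀ := by
  have h := norm_cRate_sub_le hG hm hr hq hx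
  have hne := ne_zero_of_re_pos (re_cRate_pos_of_mem_box hG hm hr hq hx)
  have h1 : ‖cRate G m x.1 x.2.1‖ * ‖cTimeRenorm G m x.1 x.2.1‖ ^ 2 = 1 := by
    rw [← norm_pow, ← norm_mul, cTimeRenorm, sq_cpow_neg_half_mul hne, norm_one]
  have hs := timeRenorm_pos hr
  have hsA := sq_timeRenorm_mul_rate hr
  have h2 : 0.6852 * rate G m q₀ v₀ ≤ ‖cRate G m x.1 x.2.1‖ := by
    have := norm_sub_norm_le (rate G m q₀ v₀ : ℂ) ((rate G m q₀ v₀ : ℂ) - cRate G m x.1 x.2.1)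
    rw [sub_sub_cancel, norm_sub_rev (rate G m q₀ v₀ : ℂ), Complex.norm_real,
      Real.norm_of_nonneg hr.le] at this
    linarith
  refine abs_le_of_sq_le_sq' ?_ (by positivity) |>.2
  have h3 : 0.6852 * rate G m q₀ v₀ * ‖cTimeRenorm G m x.1 x.2.1‖ ^ 2 ≤ 1 := by
    rw [← h1]
    gcongr
  have h4 : 0.6852 * ‖cTimeRenorm G m x.1 x.2.1‖ ^ 2 ≤ timeRenorm G m q₀ v₀ ^ 2 := by
    calc 0.6852 * ‖cTimeRenorm G m x.1 x.2.1‖ ^ 2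
        = 0.6852 * ‖cTimeRenorm G m x.1 x.2.1‖ ^ 2 *
          (timeRenorm G m q₀ v₀ ^ 2 * rate G m q₀ v₀) := by rw [hsA, mul_one]
      _ = timeRenorm G m q₀ v₀ ^ 2 *
          (0.6852 * rate G m q₀ v₀ * ‖cTimeRenorm G m x.1 x.2.1‖ ^ 2) := by ring
      _ ≤ timeRenorm G m q₀ v₀ ^ 2 * 1 := by gcongr
      _ = _ := mul_one _
  nlinarith [sq_nonneg (timeRenorm G m q₀ v₀)]

/-- The cube of `invDist` costs `1.1411 * 1.076` and the displacement `1.06`, termwise. -/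
theorem norm_cAccel_le (hG : 0 < G) (hm : ∀ i, 0 ≤ m i) (hq : NonCollision q₀)
    (hx : x ∈ box G m q₀ v₀ t₀) (i : Fin N) : ‖cAccel G m x.1 i‖ ≤ 1.302 * K G m q₀ i := by
  rw [cAccel, K, Finset.mul_sum]
  refine norm_sum_le_of_le _ fun j hj => ?_
  have hij := (Finset.ne_of_mem_erase hj).symm
  obtain ⟨u, hu, hu1, -, -, hu2⟩ := invDist_mul_bounds hq hx hij
  have hd : 0 < ‖q₀ i - q₀ j‖ := norm_pos_iff.2 (sub_ne_zero.2 (hq i j hij))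
  have h1 : ‖x.1 j - x.1 i‖ ≤ 1.06 * ‖q₀ i - q₀ j‖ := by
    have h2 := norm_le_norm_add_norm_sub' (x.1 i - x.1 j) (ofRealVec (q₀ i - q₀ j))
    have h3 := hx.1 i j hij
    rw [norm_ofRealVec] at h2
    rw [norm_sub_rev]
    linarith
  have hGm : 0 ≤ G * m j := mul_nonneg hG.le (hm j)
  have h3 : ‖u‖ ^ 3 ≤ 1.1411 * 1.076 := by
    rw [pow_succ, ← norm_pow]
    gcongr
  rw [norm_smul, hu, norm_mul, ← Complex.ofReal_mul, Complex.norm_real, Real.norm_of_nonneg hGm,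
    mul_pow, norm_mul, norm_pow, norm_pow, Complex.norm_real, Real.norm_of_nonneg (by positivity)]
  calc _ ≤ G * m j * ((1.1411 * 1.076) * (‖q₀ i - q₀ j‖⁻¹) ^ 3) * (1.06 * ‖q₀ i - q₀ j‖) := by
        gcongr
    _ = (1.1411 * 1.076 * 1.06) * (G * m j / ‖q₀ i - q₀ j‖ ^ 2) := by field_simp
    _ ≤ _ := by gcongr; norm_num

/-- The box is invariant under straight motion for a time less than `0.0444443`. -/
theorem add_smul_field_mem_box (hG : 0 < G) (hm : ∀ i, 0 ≤ m i) (hr : 0 < rate G m q₀ v₀)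
    (hq : NonCollision q₀) (hx : x ∈ box G m q₀ v₀ t₀) {z : ℂ} (hz : ‖z‖ ≤ 0.0444443) :
    ofRealPhase q₀ v₀ t₀ + z • field G m x ∈ box G m q₀ v₀ t₀ := by
  have hK := K_nonneg hG hm q₀
  have hs := timeRenorm_pos hr
  have hsA := sq_timeRenorm_mul_rate hr
  have ha := norm_cAccel_le hG hm hq hx
  have hc : ‖z * cTimeRenorm G m x.1 x.2.1‖ ≤ 0.0537 * timeRenorm G m q₀ v₀ := by
    rw [norm_mul]
    calc _ ≤ 0.0444443 * (1.2081 * timeRenorm G m q₀ v₀) :=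
          mul_le_mul hz (norm_cTimeRenorm_le hG hm hr hq hx) (norm_nonneg _) (by norm_num)
      _ ≤ _ := by linarith
  set s := timeRenorm G m q₀ v₀ with hsdef
  set c := z * cTimeRenorm G m x.1 x.2.1 with hcdef
  -- Here `0.0537` bounds `0.0444443 * 1.2081`. The relative conditions close because `0.0537 *
  -- 1.071 < 0.06` and `0.0537 * 1.302 < 0.071`; the absolute ones need only factors below `1`.
  refine ⟨fun i j hij => ?_, fun i j hij => ?_, fun i => ?_, fun i => ?_, ?_⟩
  · have e : (ofRealPhase q₀ v₀ t₀ + z • field G m x).1 i -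
        (ofRealPhase q₀ v₀ t₀ + z • field G m x).1 j - ofRealVec (q₀ i - q₀ j) =
        c • (x.2.1 i - x.2.1 j) := by
      simp only [ofRealPhase, field, Prod.fst_add, Prod.smul_fst, Pi.add_apply, Pi.smul_apply,
        complexify_apply, ← ofRealVec_sub, hcdef]
      module
    have hd : 0 < ‖q₀ i - q₀ j‖ := norm_pos_iff.2 (sub_ne_zero.2 (hq i j hij))
    have hp := pair_le_rate (v₀ := v₀) hK hij
    have hk : 0 ≤ K G m q₀ i + K G m q₀ j := add_nonneg (hK i) (hK j)
    have h2 := norm_le_norm_add_norm_sub' (x.2.1 i - x.2.1 j) (ofRealVec (v₀ i - v₀ j))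
    have h3 := hx.2.1 i j hij
    rw [norm_ofRealVec] at h2
    have h4 : s * ‖v₀ i - v₀ j‖ ≤ ‖q₀ i - q₀ j‖ := by
      refine abs_le_of_sq_le_sq' ?_ hd.le |>.2
      have : s ^ 2 * (‖v₀ i - v₀ j‖ ^ 2 / ‖q₀ i - q₀ j‖ ^ 2) ≤ 1 := by
        rw [← hsA]
        gcongr
        exact (le_add_of_nonneg_right (by positivity)).trans hp
      rw [← mul_div_assoc, div_le_one (by positivity)] at this
      rwa [mul_pow]
    have h5 : s * (s * (K G m q₀ i + K G m q₀ j)) ≤ ‖q₀ i - q₀ j‖ := by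
      have : s ^ 2 * ((K G m q₀ i + K G m q₀ j) / ‖q₀ i - q₀ j‖) ≤ 1 := by
        rw [← hsA]
        gcongr
        exact (le_add_of_nonneg_left (by positivity)).trans hp
      rw [← mul_div_assoc, div_le_one (by positivity)] at this
      rwa [← mul_assoc, ← sq]
    rw [e, norm_smul]
    calc _ ≤ (0.0537 * s) * (‖v₀ i - v₀ j‖ + 0.071 * (s * (K G m q₀ i + K G m q₀ j))) :=
          mul_le_mul hc (by linarith) (norm_nonneg _) (by positivity)
      _ = 0.0537 * (s * ‖v₀ i - v₀ j‖) +
          0.0537 * 0.071 * (s * (s * (K G m q₀ i + K G m q₀ j))) := by ring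
      _ ≤ _ := by linarith
  · have e : (ofRealPhase q₀ v₀ t₀ + z • field G m x).2.1 i -
        (ofRealPhase q₀ v₀ t₀ + z • field G m x).2.1 j - ofRealVec (v₀ i - v₀ j) =
        c • (cAccel G m x.1 i - cAccel G m x.1 j) := by
      simp only [ofRealPhase, field, Prod.fst_add, Prod.smul_fst, Prod.snd_add, Prod.smul_snd,
        Pi.add_apply, Pi.smul_apply, complexify_apply, ← ofRealVec_sub, hcdef]
      module
    rw [e, norm_smul]
    calc _ ≤ (0.0537 * s) * (1.302 * K G m q₀ i + 1.302 * K G m q₀ j) :=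
          mul_le_mul hc ((norm_sub_le _ _).trans (add_le_add (ha i) (ha j))) (norm_nonneg _)
            (by positivity)
      _ = (0.0537 * 1.302) * (s * (K G m q₀ i + K G m q₀ j)) := by ring
      _ ≤ _ := by
        have := hK i
        have := hK j
        gcongr
        norm_num
  · have e : (ofRealPhase q₀ v₀ t₀ + z • field G m x).1 i - ofRealVec (q₀ i) = c • x.2.1 i := by
      simp only [ofRealPhase, field, Prod.fst_add, Prod.smul_fst, Pi.add_apply, Pi.smul_apply,
        complexify_apply, hcdef]
      module
    have h2 := norm_le_norm_add_norm_sub' (x.2.1 i) (ofRealVec (v₀ i))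
    have h3 := hx.2.2.2.1 i
    rw [norm_ofRealVec] at h2
    rw [e, norm_smul]
    refine mul_le_mul (by linarith) (by linarith) (norm_nonneg _) hs.le
  · have e : (ofRealPhase q₀ v₀ t₀ + z • field G m x).2.1 i - ofRealVec (v₀ i) =
        c • cAccel G m x.1 i := by
      simp only [ofRealPhase, field, Prod.fst_add, Prod.smul_fst, Prod.snd_add, Prod.smul_snd,
        Pi.add_apply, Pi.smul_apply, complexify_apply, hcdef]
      module
    rw [e, norm_smul]
    calc _ ≤ (0.0537 * s) * (1.302 * K G m q₀ i) :=
          mul_le_mul hc (ha i) (norm_nonneg _) (by positivity)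
      _ = (0.0537 * 1.302) * (s * K G m q₀ i) := by ring
      _ ≤ 1 * (s * K G m q₀ i) := by
        have := hK i
        gcongr
        norm_num
      _ = _ := one_mul _
  · have e : (ofRealPhase q₀ v₀ t₀ + z • field G m x).2.2 - t₀ = c := by
      simp [ofRealPhase, field, hcdef]
    rw [e]
    linarith

end Estimates

/-! ### Local solutions in fictitious time -/

section Real

variable {N : ℕ}

/-- The points of phase space with real coordinates. -/
def realPhase (N : ℕ) : Submodule ℝ (Phase N) where
  carrier := {x | (∀ i k, (x.1 i k).im = 0) ∧ (∀ i k, (x.2.1 i k).im = 0) ∧ x.2.2.im = 0}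
  zero_mem' := by simp
  add_mem' := by
    rintro x y ⟨h1, h2, h3⟩ ⟨k1, k2, k3⟩
    exact ⟨fun i k => by simp [h1, k1], fun i k => by simp [h2, k2], by simp [h3, k3]⟩
  smul_mem' := by
    rintro r x ⟨h1, h2, h3⟩
    exact ⟨fun i k => by simp [h1], fun i k => by simp [h2], by simp [h3]⟩

theorem isClosed_realPhase : IsClosed (realPhase N : Set (Phase N)) :=
  (realPhase N).closed_of_finiteDimensional

/-- The real part of a complex configuration. -/
noncomputable def reConfig (N : ℕ) : Config ℂ N →L[ℝ] Config ℝ N :=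
  LinearMap.toContinuousLinearMap
    { toFun := fun q i => WithLp.toLp 2 fun k => (q i k).re
      map_add' := fun x y => by funext i; ext k; simp
      map_smul' := fun r x => by funext i; ext k; simp }

theorem reConfig_apply (q : Config ℂ N) (i : Fin N) (k : Fin 3) :
    reConfig N q i k = (q i k).re := rfl

@[simp] theorem reConfig_complexify (q : Config ℝ N) : reConfig N (complexify q) = q := by
  funext i
  ext k
  simp [reConfig_apply, complexify_apply]

theorem ofRealPhase_mem (q v : Config ℝ N) (t : ℝ) : ofRealPhase q v t ∈ realPhase N :=
  ⟨fun i k => by simp [ofRealPhase, complexify_apply],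
    fun i k => by simp [ofRealPhase, complexify_apply], by simp [ofRealPhase]⟩

theorem eq_ofRealPhase {x : Phase N} (hx : x ∈ realPhase N) :
    x = ofRealPhase (reConfig N x.1) (reConfig N x.2.1) x.2.2.re := by
  obtain ⟨h1, h2, h3⟩ := hx
  refine Prod.ext ?_ (Prod.ext ?_ ?_)
  · funext i
    ext k
    exact Complex.ext rfl (h1 i k)
  · funext i
    ext k
    exact Complex.ext rfl (h2 i k)
  · exact Complex.ext rfl h3

theorem field_ofRealPhase (G : ℝ) (m : Fin N → ℝ) {q v : Config ℝ N} (h : 0 ≤ rate G m q v)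
    (t : ℝ) : field G m (ofRealPhase q v t) = ofRealPhase (timeRenorm G m q v • v)
      (timeRenorm G m q v • accel G m q) (timeRenorm G m q v) :=
  field_complexify G m h t

theorem nonCollision_of_mem_box {G : ℝ} {m : Fin N → ℝ} {q₀ v₀ q v : Config ℝ N} {t₀ t : ℝ}
    (hq : NonCollision q₀) (h : ofRealPhase q v t ∈ box G m q₀ v₀ t₀) : NonCollision q := by
  intro i j hij he
  have := re_bsq_pos_of_mem_box hq h hij
  simp [ofRealPhase, complexify_apply, he, bsq] at this

/-- Through every real collision-free point passes a solution in fictitious time that is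
holomorphic in the disk of radius `0.0444443` and real on the real axis. -/
theorem exists_local_solution {G : ℝ} {m : Fin N → ℝ} (hN : 2 ≤ N) (hG : 0 < G)
    (hm : ∀ i, 0 ≤ m i) (hM : 0 < ∑ i, m i) {β : ℝ} (hβ : β = 0.0444443) {q₀ : Config ℝ N}
    (hq : NonCollision q₀) (v₀ : Config ℝ N) (t₀ : ℝ) :
    ∃ (X : ℂ → Phase N) (q v : ℝ → Config ℝ N) (T : ℝ → ℝ),
      DifferentiableOn ℂ X (ball 0 β) ∧ q 0 = q₀ ∧ v 0 = v₀ ∧ T 0 = t₀ ∧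
      ∀ r ∈ Ioo (-β) β, X r = ofRealPhase (q r) (v r) (T r) ∧ NonCollision (q r) ∧
        HasDerivAt q (timeRenorm G m (q r) (v r) • v r) r ∧
        HasDerivAt v (timeRenorm G m (q r) (v r) • accel G m (q r)) r ∧
        HasDerivAt T (timeRenorm G m (q r) (v r)) r := by
  have hr := rate_pos hN hG hm hM hq v₀
  have hβ0 : 0 < β := by rw [hβ]; norm_num
  -- Real points of the box are collision-free, so there the complex field reduces to the real one
  -- and preserves reality.
  have hreal : ∀ x ∈ box G m q₀ v₀ t₀ ∩ realPhase N, ∃ q v t, x = ofRealPhase q v t ∧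
      NonCollision q := fun x hx => by
    have he := eq_ofRealPhase hx.2
    exact ⟨_, _, _, he, nonCollision_of_mem_box hq (he ▸ hx.1)⟩
  obtain ⟨X, hX0, hX, hXB, hXS⟩ := exists_holomorphic_solution (F := field G m) (β := β)
    (S := (realPhase N : Set (Phase N))) (isCompact_box (G := G) (m := m) (q₀ := q₀) (v₀ := v₀)
      (t₀ := t₀)) convex_box isClosed_realPhase (realPhase N).convex
    (fun y hy => (analyticAt_field G m (fun i j hij => re_bsq_pos_of_mem_box hq hy hij)
      (re_cRate_pos_of_mem_box hG hm hr hq hy)).contDiffAt)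
    ⟨center_mem_box (K_nonneg hG hm q₀) hr, ofRealPhase_mem q₀ v₀ t₀⟩
    (fun z hz y hy => add_smul_field_mem_box hG hm hr hq hy
      (by rw [← hβ]; exact (mem_ball_zero_iff.1 hz).le))
    (fun r y hy => by
      obtain ⟨q, v, t, rfl, hc⟩ := hreal y hy
      rw [field_ofRealPhase G m (rate_pos hN hG hm hM hc v).le, Complex.coe_smul]
      exact (realPhase N).add_mem (ofRealPhase_mem _ _ _)
        ((realPhase N).smul_mem r (ofRealPhase_mem _ _ _))) hβ0
  refine ⟨X, fun r => reConfig N (X r).1, fun r => reConfig N (X r).2.1, fun r => (X r).2.2.re,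
    fun z hz => (hX z hz).differentiableAt.differentiableWithinAt, ?_, ?_, ?_, fun r hr' => ?_⟩
  · simp [hX0, ofRealPhase]
  · simp [hX0, ofRealPhase]
  · simp [hX0, ofRealPhase]
  have hrb : (r : ℂ) ∈ ball (0 : ℂ) β := by
    rw [mem_ball_zero_iff, Complex.norm_real, Real.norm_eq_abs]
    exact abs_lt.2 hr'
  have he := eq_ofRealPhase (hXS r hrb)
  have hc := nonCollision_of_mem_box hq (he ▸ hXB hrb)
  have hd : HasDerivAt (fun r : ℝ => X r) (field G m (X r)) r := by
    have := (hX r hrb).scomp r (h := fun s : ℝ => (s : ℂ)) Complex.ofRealCLM.hasDerivAt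
    rwa [Complex.ofRealCLM_apply, Complex.ofReal_one, one_smul] at this
  rw [he, field_ofRealPhase G m (rate_pos hN hG hm hM hc _).le] at hd
  refine ⟨he, hc, ?_, ?_, ?_⟩
  · have := (reConfig N).hasFDerivAt.comp_hasDerivAt r hd.fst
    simp only [ofRealPhase, reConfig_complexify] at this
    exact this
  · have := (reConfig N).hasFDerivAt.comp_hasDerivAt r hd.snd.fst
    simp only [ofRealPhase, reConfig_complexify] at this
    exact this
  · have := Complex.reCLM.hasFDerivAt.comp_hasDerivAt r hd.snd.snd
    simp only [ofRealPhase, Complex.reCLM_apply, Complex.ofReal_re] at this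
    exact this

end Real

/-! ### Solutions in physical time -/

section Physical

variable {N : ℕ} {G : ℝ} {m : Fin N → ℝ}

/-- `y` is a collision-free solution of the `N`-body equations at all times in `I`. -/
def SolvesOn (G : ℝ) (m : Fin N → ℝ) (I : Set ℝ) (y : ℝ → Config ℝ N × Config ℝ N) : Prop :=
  ∀ t ∈ I, NonCollision (y t).1 ∧ HasDerivAt y ((y t).2, accel G m (y t).1) t

theorem contDiffAt_accel {q : Config ℝ N} (hq : NonCollision q) :
    ContDiffAt ℝ 1 (accel G m) q := by
  have hp : ∀ i, ContDiffAt ℝ 1 (fun q : Config ℝ N => q i) q := fun i =>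
    (contDiff_apply ℝ (EuclideanSpace ℝ (Fin 3)) i).contDiffAt
  refine contDiffAt_pi.2 fun i => ContDiffAt.sum fun j hj => ?_
  have hij := (Finset.ne_of_mem_erase hj).symm
  have h0 : q i - q j ≠ 0 := sub_ne_zero.2 (hq i j hij)
  exact (contDiffAt_const.div ((((hp i).sub (hp j)).norm ℝ h0).pow 3)
    (pow_ne_zero 3 (norm_ne_zero_iff.2 h0))).smul ((hp j).sub (hp i))

theorem SolvesOn.eqOn {I : Set ℝ} (hI : IsOpen I) (hIc : I.OrdConnected)
    {y z : ℝ → Config ℝ N × Config ℝ N} (hy : SolvesOn G m I y) (hz : SolvesOn G m I z) {t₀ : ℝ}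
    (ht₀ : t₀ ∈ I) (h : y t₀ = z t₀) : EqOn y z I := by
  have hloc : ∀ t ∈ I, y t = z t → y =ᶠ[𝓝 t] z := fun t ht he => by
    have hc : ContDiffAt ℝ 1 (fun p : Config ℝ N × Config ℝ N => (p.2, accel G m p.1)) (y t) :=
      contDiffAt_snd.prodMk ((contDiffAt_accel (hy t ht).1).comp (y t) contDiffAt_fst)
    obtain ⟨L, s, hs, hL⟩ := hc.exists_lipschitzOnWith
    refine ODE_solution_unique_of_eventually (v := fun _ p => (p.2, accel G m p.1))
      (s := fun _ => s) (Eventually.of_forall fun _ => hL) ?_ ?_ he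
    · filter_upwards [hI.mem_nhds ht, (hy t ht).2.continuousAt hs] with r hr hrs
      exact ⟨(hy r hr).2, hrs⟩
    · filter_upwards [hI.mem_nhds ht, (hz t ht).2.continuousAt (he ▸ hs)] with r hr hrs
      exact ⟨(hz r hr).2, hrs⟩
  -- Connectedness is applied to equality of germs, an open condition; at limit points continuity
  -- gives equality of values and local uniqueness restores the germ.
  have hsub : I ⊆ {t | y =ᶠ[𝓝 t] z} := by
    refine hIc.isPreconnected.subset_of_closure_inter_subset (isOpen_iff_mem_nhds.2 fun t ht =>
      eventually_eventually_nhds.2 ht) ⟨t₀, ht₀, hloc t₀ ht₀ h⟩ fun t ht => ?_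
    refine hloc t ht.2 ?_
    have hf : ∃ᶠ r in 𝓝 t, y r - z r ∈ ({0} : Set (Config ℝ N × Config ℝ N)) :=
      (mem_closure_iff_frequently.1 ht.1).mono fun r hr => by
        simpa using sub_eq_zero.2 (EventuallyEq.eq_of_nhds hr)
    have hcl := isClosed_singleton.mem_of_frequently_of_tendsto hf
      ((hy t ht.2).2.continuousAt.sub (hz t ht.2).2.continuousAt)
    exact sub_eq_zero.1 hcl
  exact fun t ht => EventuallyEq.eq_of_nhds (hsub ht)

theorem SolvesOn.mono {I J : Set ℝ} {y : ℝ → Config ℝ N × Config ℝ N} (hy : SolvesOn G m I y)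
    (h : J ⊆ I) : SolvesOn G m J y := fun t ht => hy t (h ht)

theorem SolvesOn.congr {I : Set ℝ} (hI : IsOpen I) {y z : ℝ → Config ℝ N × Config ℝ N}
    (hy : SolvesOn G m I y) (h : EqOn z y I) : SolvesOn G m I z := fun t ht => by
  rw [h ht]
  exact ⟨(hy t ht).1, (hy t ht).2.congr_of_eventuallyEq
    (eventually_of_mem (hI.mem_nhds ht) h)⟩

/-- Uniqueness makes the two solutions agree on the whole overlap, so the piecewise function is
locally one of them. -/
theorem SolvesOn.exists_union {I J : Set ℝ} (hI : IsOpen I) (hIc : I.OrdConnected) (hJ : IsOpen J)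
    (hJc : J.OrdConnected) {y z : ℝ → Config ℝ N × Config ℝ N} (hy : SolvesOn G m I y)
    (hz : SolvesOn G m J z) {t₀ : ℝ} (hI₀ : t₀ ∈ I) (hJ₀ : t₀ ∈ J) (h : y t₀ = z t₀) :
    ∃ w, SolvesOn G m (I ∪ J) w ∧ EqOn w y I ∧ EqOn w z J := by
  classical
  have he := SolvesOn.eqOn (hI.inter hJ) (hIc.inter hJc) (hy.mono inter_subset_left)
    (hz.mono inter_subset_right) ⟨hI₀, hJ₀⟩ h
  have h1 : EqOn (I.piecewise y z) y I := piecewise_eqOn _ _ _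
  have h2 : EqOn (I.piecewise y z) z J := fun t ht => by
    by_cases hti : t ∈ I
    · rw [piecewise_eq_of_mem _ _ _ hti]
      exact he ⟨hti, ht⟩
    · rw [piecewise_eq_of_notMem _ _ _ hti]
  refine ⟨I.piecewise y z, fun t ht => ?_, h1, h2⟩
  rcases ht with ht | ht
  · exact hy.congr hI h1 t ht
  · exact hz.congr hJ h2 t ht

theorem IsSolution.solvesOn {q₀ v₀ : Config ℝ N} {I : Set ℝ} {q v : ℝ → Config ℝ N}
    (h : IsSolution G m q₀ v₀ I q v) : SolvesOn G m I fun t => (q t, v t) := fun t ht =>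
  ⟨h.nonCollision t ht, (hasDerivAt_pi.2 (h.deriv_q t ht)).prodMk (hasDerivAt_pi.2 (h.deriv_v t ht))⟩

theorem SolvesOn.isSolution {I : Set ℝ} (hI : IsOpen I) (hIc : I.OrdConnected) (h0 : (0 : ℝ) ∈ I)
    {y : ℝ → Config ℝ N × Config ℝ N} (hy : SolvesOn G m I y) :
    IsSolution G m (y 0).1 (y 0).2 I (fun t => (y t).1) fun t => (y t).2 where
  isOpen := hI
  ordConnected := hIc
  zero_mem := h0
  init_q := rfl
  init_v := rfl
  nonCollision t ht := (hy t ht).1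
  deriv_q t ht := hasDerivAt_pi.1 (hy t ht).2.fst
  deriv_v t ht := hasDerivAt_pi.1 (hy t ht).2.snd

/-- A maximal solution contains every solution that it meets. -/
theorem IsMaximalSolution.contains {q₀ v₀ : Config ℝ N} {I : Set ℝ} {q v : ℝ → Config ℝ N}
    (h : IsMaximalSolution G m q₀ v₀ I q v) {J : Set ℝ} (hJ : IsOpen J) (hJc : J.OrdConnected)
    {z : ℝ → Config ℝ N × Config ℝ N} (hz : SolvesOn G m J z) {t₀ : ℝ} (hI₀ : t₀ ∈ I)
    (hJ₀ : t₀ ∈ J) (he : (q t₀, v t₀) = z t₀) : J ⊆ I ∧ ∀ t ∈ J, z t = (q t, v t) := by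
  obtain ⟨hs, hmax⟩ := h
  obtain ⟨w, hw, hwI, hwJ⟩ := hs.solvesOn.exists_union hs.isOpen hs.ordConnected hJ hJc hz hI₀ hJ₀ he
  have h0 : w 0 = (q₀, v₀) := by rw [hwI hs.zero_mem, ← hs.init_q, ← hs.init_v]
  have hord : (I ∪ J).OrdConnected := (hs.ordConnected.isPreconnected.union t₀ hI₀ hJ₀
    hJc.isPreconnected).ordConnected
  have hsol := hw.isSolution (hs.isOpen.union hJ) hord (Or.inl hs.zero_mem)
  rw [h0] at hsol
  have hIJ := hmax _ _ _ hsol subset_union_left (fun t ht => congrArg Prod.fst (hwI ht))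
    fun t ht => congrArg Prod.snd (hwI ht)
  have hJI : J ⊆ I := union_eq_left.1 hIJ
  exact ⟨hJI, fun t ht => (hwJ ht).symm.trans (hwI (hJI ht))⟩

/-- If there is a solution, then there is a maximal one. -/
theorem exists_isMaximalSolution {q₀ v₀ : Config ℝ N} (hex : ∃ (J : Set ℝ)
    (z : ℝ → Config ℝ N × Config ℝ N), IsOpen J ∧ J.OrdConnected ∧ 0 ∈ J ∧ z 0 = (q₀, v₀) ∧
      SolvesOn G m J z) :
    ∃ (I : Set ℝ) (q v : ℝ → Config ℝ N), IsMaximalSolution G m q₀ v₀ I q v := by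
  classical
  let P : Set ℝ → (ℝ → Config ℝ N × Config ℝ N) → Prop := fun J z =>
    IsOpen J ∧ J.OrdConnected ∧ 0 ∈ J ∧ z 0 = (q₀, v₀) ∧ SolvesOn G m J z
  have hP : ∀ {J J' z z'}, P J z → P J' z' → ∀ t, t ∈ J → t ∈ J' → z t = z' t :=
    fun {J J' z z'} ⟨a1, a2, a3, a4, a5⟩ ⟨b1, b2, b3, b4, b5⟩ t ht ht' =>
      SolvesOn.eqOn (a1.inter b1) (a2.inter b2) (a5.mono inter_subset_left)
        (b5.mono inter_subset_right) ⟨a3, b3⟩ (a4.trans b4.symm) ⟨ht, ht'⟩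
  let I : Set ℝ := ⋃₀ {J | ∃ z, P J z}
  have hsel : ∀ t, ∃ p, ∀ J z, P J z → t ∈ J → p = z t := fun t => by
    by_cases h : ∃ J z, P J z ∧ t ∈ J
    · obtain ⟨J, z, hz, ht⟩ := h
      exact ⟨z t, fun J' z' hz' ht' => hP hz hz' t ht ht'⟩
    · exact ⟨0, fun J z hz ht => absurd ⟨J, z, hz, ht⟩ h⟩
  choose y hy using hsel
  have hyP : ∀ {J z}, P J z → EqOn y z J := fun {J z} h t ht => hy t J z h ht
  have hIo : IsOpen I := isOpen_sUnion fun J hJ => by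
    obtain ⟨z, hz⟩ := hJ
    exact hz.1
  have hIc : I.OrdConnected := by
    refine (isPreconnected_sUnion 0 _ (fun J hJ => ?_) fun J hJ => ?_).ordConnected <;>
      obtain ⟨z, hz⟩ := hJ
    · exact hz.2.2.1
    · exact hz.2.1.isPreconnected
  obtain ⟨J₀, z₀, h₀⟩ := hex
  have h0I : (0 : ℝ) ∈ I := ⟨J₀, ⟨z₀, h₀⟩, h₀.2.2.1⟩
  have hyI : SolvesOn G m I y := fun t ⟨J, ⟨z, hz⟩, ht⟩ => hz.2.2.2.2.congr hz.1 (hyP hz) t ht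
  have hy0 : y 0 = (q₀, v₀) := (hyP h₀ h₀.2.2.1).trans h₀.2.2.2.1
  have hsol := hyI.isSolution hIo hIc h0I
  rw [hy0] at hsol
  refine ⟨I, _, _, hsol, fun J q' v' hJ hIJ _ _ => Subset.antisymm (fun t ht => ?_) hIJ⟩
  exact ⟨J, ⟨fun t => (q' t, v' t), hJ.isOpen, hJ.ordConnected, hJ.zero_mem,
    Prod.ext hJ.init_q hJ.init_v, hJ.solvesOn⟩, ht⟩

/-! ### From fictitious time to physical time -/

/-- A solution in fictitious time, reparametrized by physical time. -/
theorem exists_solvesOn_of_fictitious {β : ℝ} {q v : ℝ → Config ℝ N} {T s : ℝ → ℝ}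
    (hs : ∀ r ∈ Ioo (-β) β, 0 < s r) (hc : ∀ r ∈ Ioo (-β) β, NonCollision (q r))
    (hq : ∀ r ∈ Ioo (-β) β, HasDerivAt q (s r • v r) r)
    (hv : ∀ r ∈ Ioo (-β) β, HasDerivAt v (s r • accel G m (q r)) r)
    (hT : ∀ r ∈ Ioo (-β) β, HasDerivAt T (s r) r) :
    IsOpen (T '' Ioo (-β) β) ∧ (T '' Ioo (-β) β).OrdConnected ∧
    ∃ z : ℝ → Config ℝ N × Config ℝ N, SolvesOn G m (T '' Ioo (-β) β) z ∧
      ∀ r ∈ Ioo (-β) β, z (T r) = (q r, v r) := by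
  have hTc : ContinuousOn T (Ioo (-β) β) := fun r hr => (hT r hr).continuousAt.continuousWithinAt
  have hmono : StrictMonoOn T (Ioo (-β) β) := strictMonoOn_of_deriv_pos (convex_Ioo _ _) hTc
    fun r hr => by
      rw [interior_Ioo] at hr
      rw [(hT r hr).deriv]
      exact hs r hr
  have hopen : IsOpen (T '' Ioo (-β) β) := isOpen_iff_mem_nhds.2 fun t ⟨r, hr, hrt⟩ => by
    obtain ⟨a, ha, har⟩ := exists_between hr.1
    obtain ⟨b, hrb, hb⟩ := exists_between hr.2
    have hsub : Icc a b ⊆ Ioo (-β) β := fun x hx => ⟨ha.trans_le hx.1, hx.2.trans_lt hb⟩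
    have ha' : a ∈ Ioo (-β) β := hsub ⟨le_rfl, (har.trans hrb).le⟩
    have hb' : b ∈ Ioo (-β) β := hsub ⟨(har.trans hrb).le, le_rfl⟩
    rw [← hrt]
    refine mem_of_superset (Ioo_mem_nhds (hmono ha' hr har) (hmono hr hb' hrb)) ?_
    exact (Ioo_subset_Icc_self.trans (intermediate_value_Icc (har.trans hrb).le
      (hTc.mono hsub))).trans (image_mono hsub)
  have hord : (T '' Ioo (-β) β).OrdConnected := (isPreconnected_Ioo.image _ hTc).ordConnected
  set S := Function.invFunOn T (Ioo (-β) β)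
  have hST : ∀ r ∈ Ioo (-β) β, S (T r) = r := fun r hr => hmono.injOn.leftInvOn_invFunOn hr
  have hSmono : StrictMonoOn S (T '' Ioo (-β) β) := by
    rintro _ ⟨a, ha, rfl⟩ _ ⟨b, hb, rfl⟩ hab
    rw [hST a ha, hST b hb]
    exact (hmono.lt_iff_lt ha hb).1 hab
  have hSimg : S '' (T '' Ioo (-β) β) = Ioo (-β) β := by
    rw [image_image]
    exact (image_congr hST).trans (image_id' _)
  refine ⟨hopen, hord, fun t => (q (S t), v (S t)), ?_, fun r hr => by simp only [hST r hr]⟩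
  rintro _ ⟨r, hr, rfl⟩
  have hmem : T '' Ioo (-β) β ∈ 𝓝 (T r) := hopen.mem_nhds ⟨r, hr, rfl⟩
  have hScont : ContinuousAt S (T r) := hSmono.continuousAt_of_image_mem_nhds hmem (by
    rw [hSimg, hST r hr]
    exact isOpen_Ioo.mem_nhds hr)
  -- The inverse of `T` has derivative `1 / s`, which cancels the factor `s` of the fictitious-time
  -- equations in the chain rule.
  have hSd : HasDerivAt S (s r)⁻¹ (T r) := by
    refine HasDerivAt.of_local_left_inverse hScont (by rw [hST r hr]; exact hT r hr) (hs r hr).ne' ?_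
    filter_upwards [hmem]
    rintro _ ⟨b, hb, rfl⟩
    rw [hST b hb]
  have hs0 := (hs r hr).ne'
  have key : ∀ {w : ℝ → Config ℝ N} {w' : Config ℝ N}, HasDerivAt w (s r • w') r →
      HasDerivAt (fun t => w (S t)) w' (T r) := fun {w w'} hw => by
    have := HasDerivAt.scomp (T r) (h := S) (g₁ := w) (by rw [hST r hr]; exact hw) hSd
    rwa [inv_smul_smul₀ hs0] at this
  simp only [hST r hr]
  exact ⟨hc r hr, (key (hq r hr)).prodMk (key (hv r hr))⟩

end Physical

/-! ### The fictitious time along a maximal solution -/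

section Fictitious

variable {N : ℕ} {G : ℝ} {m : Fin N → ℝ}

theorem continuousAt_timeRenorm {p : Config ℝ N × Config ℝ N} (hp : NonCollision p.1)
    (hr : 0 < rate G m p.1 p.2) :
    ContinuousAt (fun p : Config ℝ N × Config ℝ N => timeRenorm G m p.1 p.2) p := by
  have hn : ∀ i j, i ≠ j → ‖p.1 i - p.1 j‖ ≠ 0 := fun i j hij =>
    norm_ne_zero_iff.2 (sub_ne_zero.2 (hp i j hij))
  have hq : ∀ i j, ContinuousAt (fun p : Config ℝ N × Config ℝ N => ‖p.1 i - p.1 j‖) p :=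
    fun i j => by fun_prop
  have hv : ∀ i j, ContinuousAt (fun p : Config ℝ N × Config ℝ N => ‖p.2 i - p.2 j‖) p :=
    fun i j => by fun_prop
  have hK : ∀ i, ContinuousAt (fun p : Config ℝ N × Config ℝ N => K G m p.1 i) p := fun i =>
    tendsto_finsetSum _ fun j hj => continuousAt_const.div ((hq i j).pow 2)
      (pow_ne_zero 2 (hn i j (Finset.ne_of_mem_erase hj).symm))
  have hR : ContinuousAt (fun p : Config ℝ N × Config ℝ N => rate G m p.1 p.2) p := by
    refine ContinuousAt.add ?_ ?_ <;>
      refine tendsto_finsetSum _ fun i _ => tendsto_finsetSum _ fun j hj => ?_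
    · exact ((hv i j).pow 2).div ((hq i j).pow 2) (pow_ne_zero 2 (hn i j (Finset.mem_Ioi.1 hj).ne))
    · exact ((hK i).add (hK j)).div (hq i j) (hn i j (Finset.mem_Ioi.1 hj).ne)
  exact hR.rpow_const (Or.inl hr.ne')

theorem SolvesOn.hasDerivAt_fictitiousTime (hN : 2 ≤ N) (hG : 0 < G) (hm : ∀ i, 0 ≤ m i)
    (hM : 0 < ∑ i, m i) {I : Set ℝ} (hI : IsOpen I) (hIc : I.OrdConnected) (h0 : (0 : ℝ) ∈ I)
    {q v : ℝ → Config ℝ N} (h : SolvesOn G m I fun t => (q t, v t)) {t : ℝ} (ht : t ∈ I) :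
    HasDerivAt (fictitiousTime G m q v) (timeRenorm G m (q t) (v t))⁻¹ t := by
  have hc : ∀ t ∈ I, ContinuousAt (fun t => (timeRenorm G m (q t) (v t))⁻¹) t := fun t ht => by
    have hr := rate_pos hN hG hm hM (h t ht).1 (v t)
    exact (ContinuousAt.comp (f := fun t => (q t, v t)) (continuousAt_timeRenorm (h t ht).1 hr)
      (h t ht).2.continuousAt).inv₀ (timeRenorm_pos hr).ne'
  have hco : ContinuousOn (fun t => (timeRenorm G m (q t) (v t))⁻¹) I := fun t ht =>
    (hc t ht).continuousWithinAt
  exact intervalIntegral.integral_hasDerivAt_right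
    (hco.mono (hIc.uIcc_subset h0 ht)).intervalIntegrable
    (hco.stronglyMeasurableAtFilter hI t ht) (hc t ht)

theorem IsMaximalSolution.strictMonoOn_fictitiousTime (hN : 2 ≤ N) (hG : 0 < G)
    (hm : ∀ i, 0 ≤ m i) (hM : 0 < ∑ i, m i) {q₀ v₀ : Config ℝ N} {I : Set ℝ} {q v : ℝ → Config ℝ N}
    (h : IsMaximalSolution G m q₀ v₀ I q v) : StrictMonoOn (fictitiousTime G m q v) I := by
  have hd := fun t ht => h.1.solvesOn.hasDerivAt_fictitiousTime hN hG hm hM h.1.isOpen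
    h.1.ordConnected h.1.zero_mem (t := t) ht
  refine strictMonoOn_of_deriv_pos h.1.ordConnected.convex
    (fun t ht => (hd t ht).continuousAt.continuousWithinAt) fun t ht => ?_
  have ht' := interior_subset ht
  rw [(hd t ht').deriv]
  exact inv_pos.2 (timeRenorm_pos (rate_pos hN hG hm hM (h.1.nonCollision t ht') _))

/-- Along a maximal solution, an interval of length `2β` around any fictitious time is reached,
and the solution extends holomorphically to the disk with this diameter. -/
theorem IsMaximalSolution.exists_local_extension (hN : 2 ≤ N) (hG : 0 < G)
    (hm : ∀ i, 0 ≤ m i) (hM : 0 < ∑ i, m i) {β : ℝ} (hβ : β = 0.0444443) {q₀ v₀ : Config ℝ N}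
    {I : Set ℝ} {q v : ℝ → Config ℝ N} (h : IsMaximalSolution G m q₀ v₀ I q v) {t₀ : ℝ}
    (ht₀ : t₀ ∈ I) :
    ∃ X : ℂ → Phase N, DifferentiableOn ℂ X (ball 0 β) ∧ ∀ r ∈ Ioo (-β) β,
      ∃ t ∈ I, fictitiousTime G m q v t = fictitiousTime G m q v t₀ + r ∧
        X r = ofRealPhase (q t) (v t) t := by
  obtain ⟨X, q', v', T, hX, hq0, hv0, hT0, hloc⟩ := exists_local_solution hN hG hm hM hβ
    (h.1.nonCollision t₀ ht₀) (v t₀) t₀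
  have h0 : (0 : ℝ) ∈ Ioo (-β) β := by rw [hβ]; norm_num
  have hs : ∀ r ∈ Ioo (-β) β, 0 < timeRenorm G m (q' r) (v' r) := fun r hr =>
    timeRenorm_pos (rate_pos hN hG hm hM (hloc r hr).2.1 _)
  obtain ⟨hJ, hJc, z, hz, hzT⟩ := exists_solvesOn_of_fictitious (T := T) hs
    (fun r hr => (hloc r hr).2.1) (fun r hr => (hloc r hr).2.2.1)
    (fun r hr => (hloc r hr).2.2.2.1) (fun r hr => (hloc r hr).2.2.2.2)
  have hJ0 : t₀ ∈ T '' Ioo (-β) β := ⟨0, h0, hT0⟩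
  have hz0 : (q t₀, v t₀) = z t₀ := by rw [← hq0, ← hv0, ← hzT 0 h0, hT0]
  -- Maximality enters here: the whole local solution lies inside the given one.
  obtain ⟨hJI, hzq⟩ := h.contains hJ hJc hz ht₀ hJ0 hz0
  have hqv : ∀ r ∈ Ioo (-β) β, q (T r) = q' r ∧ v (T r) = v' r := fun r hr => by
    have := (hzq _ ⟨r, hr, rfl⟩).symm.trans (hzT r hr)
    exact ⟨congrArg Prod.fst this, congrArg Prod.snd this⟩
  -- Fictitious time has derivative `1 / s` in physical time and `T` has derivative `s`, so their
  -- composition differs from `r` by a constant.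
  have hd : ∀ r ∈ Ioo (-β) β,
      HasDerivAt (fun r => fictitiousTime G m q v (T r) - r) 0 r := fun r hr => by
    have h1 := h.1.solvesOn.hasDerivAt_fictitiousTime hN hG hm hM h.1.isOpen
      h.1.ordConnected h.1.zero_mem (hJI ⟨r, hr, rfl⟩)
    rw [(hqv r hr).1, (hqv r hr).2] at h1
    have h2 := (h1.comp r (hloc r hr).2.2.2.2).sub (hasDerivAt_id r)
    rw [inv_mul_cancel₀ (hs r hr).ne', sub_self] at h2
    exact h2
  refine ⟨X, hX, fun r hr => ⟨T r, hJI ⟨r, hr, rfl⟩, ?_, ?_⟩⟩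
  · have := isOpen_Ioo.is_const_of_deriv_eq_zero isPreconnected_Ioo
      (fun r hr => (hd r hr).differentiableAt.differentiableWithinAt)
      (fun r hr => (hd r hr).deriv) hr h0
    rw [hT0] at this
    linarith
  · rw [(hqv r hr).1, (hqv r hr).2]
    exact (hloc r hr).1

/-- The radius `β` is the same at every point, so the image is open, and a point within `β` of the
image already belongs to it. A nonempty clopen subset of `ℝ` is everything; in particular a solution
ending at a finite physical time uses up infinite fictitious time. -/
theorem IsMaximalSolution.bijOn_fictitiousTime (hN : 2 ≤ N) (hG : 0 < G)
    (hm : ∀ i, 0 ≤ m i) (hM : 0 < ∑ i, m i) {q₀ v₀ : Config ℝ N} {I : Set ℝ} {q v : ℝ → Config ℝ N}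
    (h : IsMaximalSolution G m q₀ v₀ I q v) : BijOn (fictitiousTime G m q v) I univ := by
  refine ⟨mapsTo_univ _ _, (h.strictMonoOn_fictitiousTime hN hG hm hM).injOn, ?_⟩
  set β : ℝ := 0.0444443 with hβ
  have hβ0 : 0 < β := by rw [hβ]; norm_num
  set A := fictitiousTime G m q v '' I
  have hA : ∀ x ∈ A, ball x β ⊆ A := by
    rintro _ ⟨t₀, ht₀, rfl⟩ y hy
    obtain ⟨X, -, hX⟩ := h.exists_local_extension hN hG hm hM hβ ht₀
    rw [mem_ball, Real.dist_eq, abs_lt] at hy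
    obtain ⟨t, ht, he, -⟩ := hX (y - fictitiousTime G m q v t₀) hy
    exact ⟨t, ht, by rw [he]; ring⟩
  have hclopen : IsClopen A := by
    refine ⟨isOpen_compl_iff.1 (Metric.isOpen_iff.2 fun x hx => ⟨β, hβ0, fun y hy hyA => hx ?_⟩),
      Metric.isOpen_iff.2 fun x hx => ⟨β, hβ0, hA x hx⟩⟩
    exact hA y hyA (mem_ball_comm.1 hy)
  exact (hclopen.eq_univ ⟨_, 0, h.1.zero_mem, rfl⟩).symm.subset

/-- The solution extends holomorphically to the strip, as a function of the fictitious time. -/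
theorem IsMaximalSolution.exists_extension_strip (hN : 2 ≤ N) (hG : 0 < G)
    (hm : ∀ i, 0 ≤ m i) (hM : 0 < ∑ i, m i) {β : ℝ} (hβ : β = 0.0444443) {q₀ v₀ : Config ℝ N}
    {I : Set ℝ} {q v : ℝ → Config ℝ N} (h : IsMaximalSolution G m q₀ v₀ I q v) :
    ∃ H : ℂ → Phase N, DifferentiableOn ℂ H (strip β) ∧ (∀ r : ℝ, H r ∈ realPhase N) ∧
      ∀ t ∈ I, H (fictitiousTime G m q v t) = ofRealPhase (q t) (v t) t := by
  have hβ0 : 0 < β := by rw [hβ]; norm_num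
  have hbij := h.bijOn_fictitiousTime hN hG hm hM
  set θ := fictitiousTime G m q v
  set S := Function.invFunOn θ I
  have hS : ∀ t ∈ I, S (θ t) = t := fun t ht => hbij.injOn.leftInvOn_invFunOn ht
  -- Surjectivity makes every real center a fictitious time `θ t₀`, so the local disk solution,
  -- translated there, supplies the hypothesis.
  obtain ⟨H, hH, hHr⟩ := exists_holomorphic_extension_strip (β := β)
    (h := fun x => ofRealPhase (q (S x)) (v (S x)) (S x)) (fun x => by
      obtain ⟨t₀, ht₀, rfl⟩ := hbij.surjOn (mem_univ x)
      obtain ⟨X, hX, hXr⟩ := h.exists_local_extension hN hG hm hM hβ ht₀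
      refine ⟨fun τ => X (τ - θ t₀), hX.comp (by fun_prop) fun τ hτ => ?_, fun r hr => ?_⟩
      · rwa [mem_ball_zero_iff, ← dist_eq_norm]
      · have hr' : r - θ t₀ ∈ Ioo (-β) β := by
          rw [mem_ball, dist_eq_norm, ← Complex.ofReal_sub, Complex.norm_real,
            Real.norm_eq_abs] at hr
          exact abs_lt.1 hr
        obtain ⟨t, ht, he, hXt⟩ := hXr _ hr'
        have hrt : θ t = r := he.trans (add_sub_cancel _ _)
        beta_reduce
        rw [← Complex.ofReal_sub, hXt, ← hrt, hS t ht]) hβ0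
  refine ⟨H, hH, fun r => ?_, fun t ht => ?_⟩
  · rw [hHr]
    exact ofRealPhase_mem _ _ _
  · rw [hHr, hS t ht]

end Fictitious

end NBody

/-! ### The main theorem -/

theorem mainTheorem3 (β : ℝ) (hβ : β = 0.0444443) :
    -- the conformal map sends the open strip one-to-one onto the open unit disk
    (DifferentiableOn ℂ (NBody.conformalMap β) (NBody.strip β) ∧
      Set.BijOn (NBody.conformalMap β) (NBody.strip β) (Metric.ball (0 : ℂ) 1)) ∧
    -- `β` serves all numbers of bodies, all masses (zero masses included) and all initial data
    ∀ (N : ℕ) (_ : 2 ≤ N) (G : ℝ) (_ : 0 < G)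
      (m : Fin N → ℝ) (_ : ∀ i, 0 ≤ m i) (_ : 0 < ∑ i, m i)
      (q₀ v₀ : NBody.Config ℝ N) (_ : NBody.NonCollision q₀),
      (∃ (I : Set ℝ) (q v : ℝ → NBody.Config ℝ N), NBody.IsMaximalSolution G m q₀ v₀ I q v) ∧
      ∀ (I : Set ℝ) (q v : ℝ → NBody.Config ℝ N), NBody.IsMaximalSolution G m q₀ v₀ I q v →
        Set.BijOn (NBody.fictitiousTime G m q v) I Set.univ ∧
        -- the solution and the physical time as functions of `τ`, holomorphic in the strip
        ∃ (qhat vhat : ℂ → NBody.Config ℂ N) (that : ℂ → ℂ),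
          DifferentiableOn ℂ qhat (NBody.strip β) ∧
          DifferentiableOn ℂ vhat (NBody.strip β) ∧
          DifferentiableOn ℂ that (NBody.strip β) ∧
          (∀ t ∈ I,
            qhat (NBody.fictitiousTime G m q v t : ℂ) = NBody.complexify (q t) ∧
            vhat (NBody.fictitiousTime G m q v t : ℂ) = NBody.complexify (v t) ∧
            that (NBody.fictitiousTime G m q v t : ℂ) = (t : ℂ)) ∧
          -- their expansions in powers of `σ`, converging on the whole unit disk
          ∃ (Q V : ℂ → NBody.Config ℂ N) (T : ℂ → ℂ)
            (a b : ℕ → NBody.Config ℝ N) (c : ℕ → ℝ),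
            (∀ σ ∈ Metric.ball (0 : ℂ) 1,
              HasSum (fun k : ℕ => σ ^ k • NBody.complexify (a k)) (Q σ) ∧
              HasSum (fun k : ℕ => σ ^ k • NBody.complexify (b k)) (V σ) ∧
              HasSum (fun k : ℕ => σ ^ k • (c k : ℂ)) (T σ)) ∧
            (∀ τ ∈ NBody.strip β,
              qhat τ = Q (NBody.conformalMap β τ) ∧
              vhat τ = V (NBody.conformalMap β τ) ∧
              that τ = T (NBody.conformalMap β τ)) := by
  have hβ0 : 0 < β := by rw [hβ]; norm_num
  refine ⟨⟨NBody.differentiableOn_conformalMap hβ0, NBody.bijOn_conformalMap hβ0⟩, ?_⟩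
  intro N hN G hG m hm hM q₀ v₀ hq₀
  refine ⟨?_, fun I q v h => ⟨h.bijOn_fictitiousTime hN hG hm hM, ?_⟩⟩
  -- The local solution started at physical time `0` also supplies the solution needed for existence
  -- of a maximal one.
  · obtain ⟨X, q, v, T, -, hq0, hv0, hT0, hloc⟩ :=
      NBody.exists_local_solution hN hG hm hM hβ hq₀ v₀ 0
    have h0 : (0 : ℝ) ∈ Set.Ioo (-β) β := ⟨neg_lt_zero.2 hβ0, hβ0⟩
    obtain ⟨hJ, hJc, z, hz, hzT⟩ := NBody.exists_solvesOn_of_fictitious (T := T)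
      (fun r hr => NBody.timeRenorm_pos (NBody.rate_pos hN hG hm hM (hloc r hr).2.1 (v r)))
      (fun r hr => (hloc r hr).2.1) (fun r hr => (hloc r hr).2.2.1)
      (fun r hr => (hloc r hr).2.2.2.1) (fun r hr => (hloc r hr).2.2.2.2)
    exact NBody.exists_isMaximalSolution
      ⟨_, z, hJ, hJc, ⟨0, h0, hT0⟩, by rw [← hT0, hzT 0 h0, hq0, hv0], hz⟩
  · obtain ⟨H, hH, hHS, hHt⟩ := h.exists_extension_strip hN hG hm hM hβ
    obtain ⟨Q, a, haS, haQ, hHQ⟩ :=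
      NBody.exists_powerSeries_conformalMap hβ0 NBody.isClosed_realPhase hH hHS
    -- The phase-space coefficients are real, so taking real parts and complexifying again loses
    -- nothing.
    have ha : ∀ k, a k = NBody.ofRealPhase (NBody.reConfig N (a k).1)
        (NBody.reConfig N (a k).2.1) (a k).2.2.re := fun k => NBody.eq_ofRealPhase (haS k)
    refine ⟨fun τ => (H τ).1, fun τ => (H τ).2.1, fun τ => (H τ).2.2,
      hH.fst, hH.snd.fst, hH.snd.snd, fun t ht => ?_, fun σ => (Q σ).1, fun σ => (Q σ).2.1,
      fun σ => (Q σ).2.2, fun k => NBody.reConfig N (a k).1, fun k => NBody.reConfig N (a k).2.1,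
      fun k => (a k).2.2.re, fun σ hσ => ?_, fun τ hτ => ?_⟩
    · beta_reduce
      rw [hHt t ht]
      exact ⟨rfl, rfl, rfl⟩
    · have hs := haQ σ hσ
      have h1 := hs.mapL (ContinuousLinearMap.fst ℂ (NBody.Config ℂ N) (NBody.Config ℂ N × ℂ))
      have h2 := hs.mapL (ContinuousLinearMap.snd ℂ (NBody.Config ℂ N) (NBody.Config ℂ N × ℂ))
      have h3 := h2.mapL (ContinuousLinearMap.fst ℂ (NBody.Config ℂ N) ℂ)
      have h4 := h2.mapL (ContinuousLinearMap.snd ℂ (NBody.Config ℂ N) ℂ)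
      refine ⟨h1.congr_fun fun k => ?_, h3.congr_fun fun k => ?_, h4.congr_fun fun k => ?_⟩
      · exact (congrArg (fun x : NBody.Phase N => σ ^ k • x.1) (ha k)).symm
      · exact (congrArg (fun x : NBody.Phase N => σ ^ k • x.2.1) (ha k)).symm
      · exact (congrArg (fun x : NBody.Phase N => σ ^ k • x.2.2) (ha k)).symm
    · beta_reduce
      rw [hHQ τ hτ]
      exact ⟨rfl, rfl, rfl⟩
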